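/- **Theorem 1.1.** Let $N\in\{2,3\}$. Let $H^2_{0,0}(\mathbb R^N)$ denote the closure of the real-valued functions in $C_c^\infty(\mathbb R^N)$ with respect to the norm $\left(\int_{\mathbb R^N}|\Delta u|^2\,dx+\int_{\mathbb R^N}|\nabla u|^2\,dx\right)^{1/2}$; that is, the space of all $u\in L^1_{\mathrm{loc}}(\mathbb R^N)$ for which there are $\varphi_n\in C_c^\infty(\mathbb R^N)$ with $\varphi_n\to u$ in $L^1_{\mathrm{loc}}$, $\nabla\varphi_n\to\nabla u$ in $L^2$ and $\Delta\varphi_n\to\Delta u$ in $L^2$ (weak derivatives). Consider the second order Hydrogen uncertainty principle $$\int_{\mathbb R^N}|\Delta u|^2\,dx\int_{\mathbb R^N}|\nabla u|^2\,dx\;\ge\; C\left(\int_{\mathbb R^N}\frac{|\nabla u|^2}{|x|}\,dx\right)^2 .\qquad(*)$$ The integral on the right is finite for all $u\in H^2_{0,0}(\mathbb R^N)$, there is a largest real constant $C=C(N)$ (the sharp constant) for which $(*)$ holds for all $u\in C_c^\infty(\mathbb R^N)$, this is also the largest constant for which $(*)$ holds for all $u\in H^2_{0,0}(\mathbb R^N)$,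 and $$\frac{(N-1)^4(N+3)^2}{4(N^2-2N+5)^2}\;\le\; C(N)\;\le\;\frac{N(N+4)(N^2-1)^2}{4(N^2-N+4)^2}\;<\;\frac{(N+1)^2}{4}.$$ Moreover, any extremal function, i.e. any $u\in H^2_{0,0}(\mathbb R^N)$ with $\nabla u\not\equiv0$ for which equality holds in $(*)$ with $C=C(N)$, is non-radial: it does not agree almost everywhere with a function of $|x|$. -/

import Mathlib

open MeasureTheory Filter Topology
open scoped ContDiff

/-- Real-valued smooth functions with compact support on `ℝ^N`, i.e. `C_c^∞(ℝ^N)`. -/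
def IsTestFunction {N : ℕ} (u : EuclideanSpace ℝ (Fin N) → ℝ) : Prop :=
  ContDiff ℝ ∞ u ∧ HasCompactSupport u

/-- `u` lies in the second order Sobolev space `H²_{0,0}(ℝ^N)`, the closure of `C_c^∞(ℝ^N)` with
respect to the norm `(∫ |Δu|² + ∫ |∇u|²)^{1/2}`, with gradient `G` and Laplacian `g`.

The closure is taken among locally integrable functions: there are test functions `φ n` with
`φ n → u` in `L¹_loc`, `∇ (φ n) → G` in `L²` and `Δ (φ n) → g` in `L²`. Testing against smooth
functions of compact support, one sees that `G` and `g` are the distributional gradient and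
Laplacian of `u`; so `u` determines them up to null sets. -/
structure MemH2 {N : ℕ} (u : EuclideanSpace ℝ (Fin N) → ℝ)
    (G : EuclideanSpace ℝ (Fin N) → EuclideanSpace ℝ (Fin N))
    (g : EuclideanSpace ℝ (Fin N) → ℝ) : Prop where
  locallyIntegrable : LocallyIntegrable u volume
  memLp_grad : MemLp G 2 volume
  memLp_laplacian : MemLp g 2 volume
  exists_approx : ∃ φ : ℕ → EuclideanSpace ℝ (Fin N) → ℝ,
    (∀ n, IsTestFunction (φ n)) ∧
    (∀ K : Set (EuclideanSpace ℝ (Fin N)), IsCompact K →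
      Tendsto (fun n => ∫⁻ x in K, ‖φ n x - u x‖ₑ) atTop (𝓝 0)) ∧
    Tendsto (fun n => eLpNorm (fun x => gradient (φ n) x - G x) 2 volume) atTop (𝓝 0) ∧
    Tendsto (fun n => eLpNorm (fun x => Laplacian.laplacian (φ n) x - g x) 2 volume)
      atTop (𝓝 0)

/-- The second order Hydrogen uncertainty inequality with constant `C` for a function with
gradient `G` and Laplacian `g`; the weighted integral on the right is required to be finite. -/
def HydrogenIneq {N : ℕ} (C : ℝ) (G : EuclideanSpace ℝ (Fin N) → EuclideanSpace ℝ (Fin N))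
    (g : EuclideanSpace ℝ (Fin N) → ℝ) : Prop :=
  Integrable (fun x => ‖G x‖ ^ 2 / ‖x‖) volume ∧
    C * (∫ x, ‖G x‖ ^ 2 / ‖x‖) ^ 2 ≤ (∫ x, g x ^ 2) * ∫ x, ‖G x‖ ^ 2

/-- The constants for which the inequality holds for all `u ∈ C_c^∞(ℝ^N)`. -/
def testConstants (N : ℕ) : Set ℝ :=
  {C | ∀ u : EuclideanSpace ℝ (Fin N) → ℝ, IsTestFunction u →
    HydrogenIneq C (gradient u) (Laplacian.laplacian u)}

/-- The constants for which the inequality holds for all `u ∈ H²_{0,0}(ℝ^N)`. -/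
def sobolevConstants (N : ℕ) : Set ℝ :=
  {C | ∀ (u : EuclideanSpace ℝ (Fin N) → ℝ)
      (G : EuclideanSpace ℝ (Fin N) → EuclideanSpace ℝ (Fin N))
      (g : EuclideanSpace ℝ (Fin N) → ℝ), MemH2 u G g → HydrogenIneq C G g}

/-- `u ∈ H²_{0,0}(ℝ^N)`, with gradient `G` and Laplacian `g`, is a nontrivial function for which
the inequality with constant `C` is an equality. Nontrivial means `∇u ≠ 0`: all the integrals
depend on `∇u` only. -/
def IsExtremal {N : ℕ} (C : ℝ) (u : EuclideanSpace ℝ (Fin N) → ℝ)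
    (G : EuclideanSpace ℝ (Fin N) → EuclideanSpace ℝ (Fin N))
    (g : EuclideanSpace ℝ (Fin N) → ℝ) : Prop :=
  MemH2 u G g ∧ ¬ (G =ᵐ[volume] 0) ∧
    (∫ x, g x ^ 2) * (∫ x, ‖G x‖ ^ 2) = C * (∫ x, ‖G x‖ ^ 2 / ‖x‖) ^ 2

/-- `u` agrees almost everywhere with a function of `|x|`. -/
def IsRadialAE {N : ℕ} (u : EuclideanSpace ℝ (Fin N) → ℝ) : Prop :=
  ∃ f : ℝ → ℝ, u =ᵐ[volume] fun x => f ‖x‖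

/-! Everything rests on one refined inequality. Put `V = ∇u`, `ξ = x/|x|` and `n = N - 1`. Then the
integral of `((n + 2 - 2/n)|V|² + (2/n)(V·ξ)²)/|x|` has square at most `4 ∫|Δu|² ∫|V|²`
(`sq_integral_radialDensity_gradient_le`). Its proof integrates, for each real `t`, a pointwise
nonnegative quadratic form in the Hessian and `tV` (`hessian_quadratic_form_nonneg`). The Hessian
and the Laplacian have the same `L²` norm (`integral_laplacian_sq`). The cross terms are, up to the
weighted density, divergences of `|V|² ξ` and `(V·ξ) V`, which integrate to zero despite the
singularity of `ξ` (`integral_divergence_conical`). The discriminant in `t` gives the claim.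

Dropping the term `(V·ξ)²` gives the lower bound for `C(N)`. If `u` is radial, `V` is parallel to
`x`, the two weights add up to `N + 1`, and the inequality holds with the larger constant `(N +
1)²/4` (`MemH2.radial_hydrogen`). The trial function `x_i e^{-|x|}`, smoothed and cut off, shows
that `C(N)` is strictly smaller (`le_of_mem_testConstants`), so no extremal function is radial.

Fatou's lemma carries inequalities from test functions to the closure
(`MemH2.sq_integral_radialDensity_le`). That weak gradients of radial functions are parallel to `x`
is proved by testing against generators of rotations (`MemH2.inner_sq_eq_of_isRadialAE`). -/

open scoped RealInnerProductSpace

/-! ### Linear algebra of symmetric operators with a distinguished direction -/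

section Pointwise

variable {E ι : Type*} [NormedAddCommGroup E] [InnerProductSpace ℝ E] [Fintype ι]

/-- Among symmetric operators with prescribed `T ξ` and prescribed trace, the Frobenius norm is
smallest when the compression of `T` to the orthogonal complement of `ξ` is a multiple of the
identity. -/
lemma sum_norm_sq_ge_of_isSymmetric (b : OrthonormalBasis ι ℝ E) {T : E →ₗ[ℝ] E}
    (hT : T.IsSymmetric) {ξ : E} (hξ : ‖ξ‖ = 1) {n β : ℝ} (hn : (Fintype.card ι : ℝ) = n + 1)
    (hβ : n * β = ∑ i, ⟪T (b i), b i⟫ - ⟪T ξ, ξ⟫) :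
    2 * ‖T ξ‖ ^ 2 - ⟪T ξ, ξ⟫ ^ 2 + n * β ^ 2 ≤ ∑ i, ‖T (b i)‖ ^ 2 := by
  set h := ⟪T ξ, ξ⟫ with hh
  -- The minimiser is `S v = ⟪v, ξ⟫ a + ⟪v, a⟫ ξ + β v`. This `a` makes `S ξ = T ξ`, while `S`
  -- compresses to `β` on the complement of `ξ`. The lemma is `0 ≤ ‖T - S‖²` in Frobenius norm,
  -- expanded.
  set a : E := T ξ - ((h + β) / 2) • ξ with ha
  have hξξ : ⟪ξ, ξ⟫ = 1 := by rw [real_inner_self_eq_norm_sq, hξ]; norm_num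
  have key : ∀ i, ‖T (b i) - (⟪b i, ξ⟫ • a + ⟪b i, a⟫ • ξ + β • b i)‖ ^ 2
      = ‖T (b i)‖ ^ 2 - 2 * (⟪T a, b i⟫ * ⟪b i, ξ⟫) - 2 * (⟪T ξ, b i⟫ * ⟪b i, a⟫)
        - 2 * β * ⟪T (b i), b i⟫
        + ‖a‖ ^ 2 * (⟪ξ, b i⟫ * ⟪b i, ξ⟫) + ⟪a, b i⟫ * ⟪b i, a⟫ + β ^ 2
        + 2 * ⟪a, ξ⟫ * (⟪a, b i⟫ * ⟪b i, ξ⟫) + 4 * β * (⟪a, b i⟫ * ⟪b i, ξ⟫) := by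
    intro i
    have hb : ⟪b i, b i⟫ = 1 := by
      rw [real_inner_self_eq_norm_sq, b.norm_eq_one]; norm_num
    rw [← real_inner_self_eq_norm_sq, ← real_inner_self_eq_norm_sq a,
      ← real_inner_self_eq_norm_sq (T (b i))]
    simp only [inner_sub_left, inner_sub_right, inner_add_left, inner_add_right,
      real_inner_smul_left, real_inner_smul_right, hξξ, hb, hT a (b i), hT ξ (b i),
      real_inner_comm a ξ, real_inner_comm (b i) ξ, real_inner_comm (b i) a,
      real_inner_comm (T (b i)) a, real_inner_comm (T (b i)) ξ,
      real_inner_comm (T (b i)) (b i)]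
    ring
  have hsum := Finset.sum_nonneg fun i (_ : i ∈ Finset.univ) =>
    sq_nonneg ‖T (b i) - (⟪b i, ξ⟫ • a + ⟪b i, a⟫ • ξ + β • b i)‖
  simp only [key, Finset.sum_add_distrib, Finset.sum_sub_distrib, ← Finset.mul_sum,
    b.sum_inner_mul_inner, Finset.sum_const, Finset.card_univ, nsmul_eq_mul, hn] at hsum
  have h1 : ⟪T a, ξ⟫ = ⟪T ξ, a⟫ := by rw [hT a ξ, real_inner_comm]
  have h2 : ⟪T ξ, a⟫ = ‖T ξ‖ ^ 2 - (h + β) / 2 * h := by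
    rw [ha, inner_sub_right, real_inner_smul_right, real_inner_self_eq_norm_sq]
  have h3 : ⟪a, ξ⟫ = (h - β) / 2 := by
    rw [ha, inner_sub_left, real_inner_smul_left, hξξ, ← hh]; ring
  have h4 : ‖a‖ ^ 2 = ‖T ξ‖ ^ 2 - (h + β) * h + (h + β) ^ 2 / 4 := by
    rw [ha, norm_sub_sq_real, real_inner_smul_right, norm_smul, hξ, ← hh, mul_one,
      Real.norm_eq_abs, sq_abs]
    ring
  rw [h1, h2, real_inner_self_eq_norm_sq a, h3, hξξ, h4] at hsum
  have h5 : ∑ i, ⟪T (b i), b i⟫ = n * β + h := by rw [hβ]; ring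
  rw [h5] at hsum
  nlinarith [hsum]

/-- The algebraic core of the second order inequality. -/
lemma hessian_quadratic_form_nonneg (b : OrthonormalBasis ι ℝ E) {T : E →ₗ[ℝ] E}
    (hT : T.IsSymmetric) {ξ : E} (hξ : ‖ξ‖ = 1) (V : E) (t : ℝ) {n : ℝ} (hn1 : 1 ≤ n)
    (hn : (Fintype.card ι : ℝ) = n + 1) :
    0 ≤ (n + 1) / n * ∑ i, ‖T (b i)‖ ^ 2 - 1 / n * (∑ i, ⟪T (b i), b i⟫) ^ 2 + t ^ 2 * ‖V‖ ^ 2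
      + t * (2 * (n + 1) / n * ⟪T ξ, V⟫ - 2 / n * (⟪V, ξ⟫ * ∑ i, ⟪T (b i), b i⟫)) := by
  have hn0 : 0 < n := by linarith
  set tr := ∑ i, ⟪T (b i), b i⟫ with htr
  obtain ⟨β, hβ⟩ : ∃ β, n * β = tr - ⟪T ξ, ξ⟫ := ⟨(tr - ⟪T ξ, ξ⟫) / n, by field_simp⟩
  have h1 := sum_norm_sq_ge_of_isSymmetric b hT hξ hn hβ
  set h := ⟪T ξ, ξ⟫ with hh
  set p := ⟪V, ξ⟫ with hp
  have htr' : tr = n * β + h := by rw [hβ]; ring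
  have hξξ : ⟪ξ, ξ⟫ = 1 := by rw [real_inner_self_eq_norm_sq, hξ]; norm_num
  -- Only the parts of `T ξ` and `V` orthogonal to `ξ` enter here; this square absorbs the
  -- tangential cross term.
  have hw : ‖(T ξ - h • ξ) + (t / 2) • (V - p • ξ)‖ ^ 2
      = ‖T ξ‖ ^ 2 - h ^ 2 + t * (⟪T ξ, V⟫ - h * p) + t ^ 2 / 4 * (‖V‖ ^ 2 - p ^ 2) := by
    rw [← real_inner_self_eq_norm_sq, ← real_inner_self_eq_norm_sq, ← real_inner_self_eq_norm_sq]
    simp only [inner_sub_left, inner_sub_right, inner_add_left, inner_add_right,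
      real_inner_smul_left, real_inner_smul_right, hξξ, ← hh, ← hp, real_inner_comm (T ξ) ξ,
      real_inner_comm V (T ξ)]
    ring_nf
    simp only [real_inner_comm V ξ, ← hp]
    ring
  have hw0 := sq_nonneg ‖(T ξ - h • ξ) + (t / 2) • (V - p • ξ)‖
  have hq : p ^ 2 ≤ ‖V‖ ^ 2 := by
    have := abs_real_inner_le_norm V ξ
    rw [hξ, mul_one] at this
    exact sq_le_sq' (by linarith [neg_abs_le p]) ((le_abs_self p).trans this)
  -- This is where dimension at least two is used: the leftover tangential coefficient `1 - (n +
  -- 1)/(2n)` is nonnegative.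
  have hk : (n + 1) / n ≤ 2 := by rw [div_le_iff₀ hn0]; linarith
  have hk0 : 0 ≤ (n + 1) / n := by positivity
  have hsq := sq_nonneg (h - β + t * p)
  rw [hw] at hw0
  -- With weight `1/n` on the squared trace, the pure `h, β` part is exactly `(h - β)²`. It is the
  -- largest weight keeping the form nonnegative, since it degenerates on multiples of the identity.
  have e : (n + 1) / n * (2 * ‖T ξ‖ ^ 2 - h ^ 2 + n * β ^ 2) - 1 / n * tr ^ 2 + t ^ 2 * ‖V‖ ^ 2
      + t * (2 * (n + 1) / n * ⟪T ξ, V⟫ - 2 / n * (p * tr))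
      = (h - β + t * p) ^ 2 + 2 * ((n + 1) / n) *
        (‖T ξ‖ ^ 2 - h ^ 2 + t * (⟪T ξ, V⟫ - h * p) + t ^ 2 / 4 * (‖V‖ ^ 2 - p ^ 2))
        + t ^ 2 * (1 - (n + 1) / n / 2) * (‖V‖ ^ 2 - p ^ 2) := by
    rw [htr']; field_simp; ring
  have := mul_le_mul_of_nonneg_left h1 hk0
  have h3 : 0 ≤ t ^ 2 * (1 - (n + 1) / n / 2) * (‖V‖ ^ 2 - p ^ 2) := by
    apply mul_nonneg (mul_nonneg (sq_nonneg t) (by linarith)) (by linarith)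
  have h4 := mul_nonneg (mul_nonneg zero_le_two hk0) hw0
  linarith

end Pointwise

/-! ### Derivatives of the radial field, gradients and Hessians -/

section Calculus

/-- The derivative is `|x|⁻¹` times the projection onto the complement of `x`. Its trace `n/|x|` and
its quadratic form produce the weighted terms of the main inequality. -/
lemma hasFDerivAt_norm_inv_smul {E : Type*} [NormedAddCommGroup E] [InnerProductSpace ℝ E]
    {x : E} (hx : x ≠ 0) :
    HasFDerivAt (fun y : E => ‖y‖⁻¹ • y)
      (‖x‖⁻¹ • (ContinuousLinearMap.id ℝ E -
        (innerSL ℝ (‖x‖⁻¹ • x)).smulRight (‖x‖⁻¹ • x))) x := by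
  have hx' : ‖x‖ ≠ 0 := norm_ne_zero_iff.2 hx
  have h1 : HasFDerivAt (fun y : E => ‖y‖) (‖x‖⁻¹ • innerSL ℝ x) x := by
    have h := (hasStrictFDerivAt_norm_sq x).hasFDerivAt.sqrt (by positivity)
    simp only [norm_nonneg, Real.sqrt_sq] at h
    convert h using 1
    ext v
    simp
    field_simp
  have h2 := ((hasDerivAt_inv hx').comp_hasFDerivAt x h1).smul (hasFDerivAt_id x)
  refine HasFDerivAt.congr_fderiv h2 ?_
  ext v
  change ‖x‖⁻¹ • v + (-(‖x‖ ^ 2)⁻¹ * (‖x‖⁻¹ * ⟪x, v⟫)) • x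
    = ‖x‖⁻¹ • (v - ⟪‖x‖⁻¹ • x, v⟫ • ‖x‖⁻¹ • x)
  rw [real_inner_smul_left, smul_sub, smul_smul, smul_smul, sub_eq_add_neg, ← neg_smul]
  congr 2
  field_simp

variable {E : Type*} [NormedAddCommGroup E] [InnerProductSpace ℝ E] [CompleteSpace E]

lemma inner_gradient (u : E → ℝ) (x v : E) : ⟪gradient u x, v⟫ = fderiv ℝ u x v := by
  simp [gradient]

lemma ContDiff.gradient_infty {u : E → ℝ} (hu : ContDiff ℝ ∞ u) : ContDiff ℝ ∞ (gradient u) := by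
  have : gradient u = fun x => (InnerProductSpace.toDual ℝ E).symm (fderiv ℝ u x) := rfl
  rw [this]
  exact (InnerProductSpace.toDual ℝ E).symm.toContinuousLinearEquiv.contDiff.comp
    (hu.fderiv_right (m := ∞) (by norm_num))

lemma HasCompactSupport.gradient' {u : E → ℝ} (hu : HasCompactSupport u) :
    HasCompactSupport (gradient u) := by
  have := hu.fderiv (𝕜 := ℝ)
  exact this.comp_left (g := (InnerProductSpace.toDual ℝ E).symm) (map_zero _)

lemma inner_fderiv_gradient {u : E → ℝ} (hu : ContDiff ℝ ∞ u) (x v w : E) :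
    ⟪fderiv ℝ (gradient u) x v, w⟫ = fderiv ℝ (fderiv ℝ u) x v w := by
  have h1 : (fun y => ⟪gradient u y, w⟫) = fun y => fderiv ℝ u y w := by
    ext y; exact inner_gradient u y w
  have h2 : DifferentiableAt ℝ (gradient u) x := hu.gradient_infty.differentiable (by simp) x
  have h3 : DifferentiableAt ℝ (fderiv ℝ u) x :=
    (hu.fderiv_right (m := ∞) (by norm_num)).differentiable (by simp) x
  have h4 : fderiv ℝ (fun y => ⟪gradient u y, w⟫) x v = ⟪fderiv ℝ (gradient u) x v, w⟫ := by
    rw [fderiv_inner_apply ℝ h2 (differentiableAt_const w)]; simp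
  rw [← h4, h1, fderiv_clm_apply h3 (differentiableAt_const w)]
  simp

lemma isSymmetric_fderiv_gradient {u : E → ℝ} (hu : ContDiff ℝ ∞ u) (x : E) :
    (fderiv ℝ (gradient u) x : E →ₗ[ℝ] E).IsSymmetric := by
  intro v w
  have hs : IsSymmSndFDerivAt ℝ u x := hu.contDiffAt.isSymmSndFDerivAt
    (by simpa using WithTop.coe_le_coe.2 (le_top : (2 : ℕ∞) ≤ ⊤))
  have := hs v w
  simp only [ContinuousLinearMap.coe_coe]
  rw [inner_fderiv_gradient hu, this, ← inner_fderiv_gradient hu, real_inner_comm]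

lemma laplacian_eq_sum_inner {ι : Type*} [Fintype ι] [FiniteDimensional ℝ E]
    (b : OrthonormalBasis ι ℝ E) {u : E → ℝ} (hu : ContDiff ℝ ∞ u) (x : E) :
    Laplacian.laplacian u x = ∑ i, ⟪fderiv ℝ (gradient u) x (b i), b i⟫ := by
  rw [InnerProductSpace.laplacian_eq_iteratedFDeriv_orthonormalBasis u b]
  simp [iteratedFDeriv_two_apply, inner_fderiv_gradient hu]

lemma inner_fderiv_gradient_eq {u : E → ℝ} (hu : ContDiff ℝ ∞ u) (x v w : E) :
    ⟪fderiv ℝ (gradient u) x v, w⟫ = fderiv ℝ (fun y => fderiv ℝ u y w) x v := by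
  have h3 : DifferentiableAt ℝ (fderiv ℝ u) x :=
    (hu.fderiv_right (m := ∞) (by norm_num)).differentiable (by simp) x
  rw [inner_fderiv_gradient hu, fderiv_clm_apply h3 (differentiableAt_const w)]
  simp

lemma continuous_fderiv_gradient {u : E → ℝ} (hu : ContDiff ℝ ∞ u) :
    Continuous (fderiv ℝ (gradient u)) :=
  hu.gradient_infty.continuous_fderiv (by simp)

end Calculus

/-! ### Bounds for the smooth step function -/

section SmoothTransition

lemma Real.smoothTransition.hasCompactSupport_deriv :
    HasCompactSupport (deriv Real.smoothTransition) := by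
  refine HasCompactSupport.intro (isCompact_Icc (a := (0 : ℝ)) (b := 1)) fun x hx => ?_
  rw [Set.mem_Icc, not_and_or, not_le, not_le] at hx
  rcases hx with hx | hx
  · have : Real.smoothTransition =ᶠ[𝓝 x] fun _ => 0 := by
      filter_upwards [Iio_mem_nhds hx] with y hy
      exact Real.smoothTransition.zero_of_nonpos (le_of_lt hy)
    rw [this.deriv_eq, deriv_const]
  · have : Real.smoothTransition =ᶠ[𝓝 x] fun _ => 1 := by
      filter_upwards [Ioi_mem_nhds hx] with y hy
      exact Real.smoothTransition.one_of_one_le (le_of_lt hy)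
    rw [this.deriv_eq, deriv_const]

lemma Real.smoothTransition.deriv_of_one_lt {x : ℝ} (hx : 1 < x) :
    deriv Real.smoothTransition x = 0 := by
  have : Real.smoothTransition =ᶠ[𝓝 x] fun _ => 1 := by
    filter_upwards [Ioi_mem_nhds hx] with y hy
    exact Real.smoothTransition.one_of_one_le (le_of_lt hy)
  rw [this.deriv_eq, deriv_const]

lemma Real.smoothTransition.exists_deriv_bound :
    ∃ L, 0 ≤ L ∧ ∀ x, |deriv Real.smoothTransition x| ≤ L := by
  have hc : Continuous (deriv Real.smoothTransition) :=
    (Real.smoothTransition.contDiff (n := 1)).continuous_deriv (by simp)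
  obtain ⟨L, hL⟩ := hc.bounded_above_of_compact_support
    Real.smoothTransition.hasCompactSupport_deriv
  exact ⟨L, (norm_nonneg _).trans (hL 0), hL⟩

end SmoothTransition

/-! ### Integration by parts across a point singularity -/

section Singular

variable {E : Type*} [NormedAddCommGroup E] [InnerProductSpace ℝ E] [FiniteDimensional ℝ E]
  [MeasurableSpace E] [BorelSpace E]

/-- In polar coordinates the integrand becomes `r^(d-2)`, which is continuous up to `r = 0` once `d
≥ 2`. -/
lemma integrableOn_inv_norm_ball (hd : 2 ≤ Module.finrank ℝ E) (R : ℝ) :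
    IntegrableOn (fun x : E => ‖x‖⁻¹) (Metric.ball 0 R) := by
  have : Nontrivial E := Module.nontrivial_of_finrank_pos (R := ℝ) (by omega)
  rw [integrableOn_fun_norm_addHaar volume (f := fun y => y⁻¹)]
  have h : IntegrableOn (fun y : ℝ => y ^ (Module.finrank ℝ E - 2)) (Set.Ioo 0 R) :=
    ((continuous_pow _).integrableOn_Icc (a := 0) (b := R)).mono_set Set.Ioo_subset_Icc_self
  refine h.congr_fun (fun y hy => ?_) measurableSet_Ioo
  have hy0 : y ≠ 0 := hy.1.ne'
  have : Module.finrank ℝ E - 1 = (Module.finrank ℝ E - 2) + 1 := by omega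
  simp only [smul_eq_mul]
  rw [this, pow_succ, mul_assoc, mul_inv_cancel₀ hy0, mul_one]

/-- A function of compact support with at most an inverse first power singularity at the origin is
integrable in dimension at least two. -/
lemma integrable_of_abs_le_mul_inv_norm (hd : 2 ≤ Module.finrank ℝ E) {f : E → ℝ}
    (hf : AEStronglyMeasurable f) (hc : HasCompactSupport f) {K : ℝ}
    (hK : ∀ x, x ≠ 0 → |f x| ≤ K * ‖x‖⁻¹) : Integrable f := by
  have : Nontrivial E := Module.nontrivial_of_finrank_pos (R := ℝ) (by omega)
  obtain ⟨R, hR⟩ := hc.isCompact.isBounded.subset_ball 0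
  have h1 : IntegrableOn f (Metric.ball 0 R) := by
    refine Integrable.mono' ((integrableOn_inv_norm_ball hd R).const_mul K) hf.restrict ?_
    refine ae_restrict_of_ae ?_
    filter_upwards [show ∀ᵐ x : E, x ≠ 0 by simp [ae_iff]] with x hx using hK x hx
  rwa [integrableOn_iff_integrable_of_support_subset ((subset_tsupport f).trans hR)] at h1

lemma aestronglyMeasurable_of_continuousOn_compl_zero {F : Type*} [NormedAddCommGroup F]
    [SecondCountableTopology F] [Nontrivial E]
    {f : E → F} (hf : ContinuousOn f {0}ᶜ) : AEStronglyMeasurable f := by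
  have := hf.aestronglyMeasurable (μ := volume) (measurableSet_singleton (0 : E)).compl
  rwa [restrict_compl_singleton] at this

/-- Integral of a directional derivative of a bounded function of compact support which is
differentiable away from the origin. -/
lemma integral_eq_zero_of_hasFDerivAt_compl_zero (hd : 2 ≤ Module.finrank ℝ E) {f : E → ℝ}
    {f' : E → E →L[ℝ] ℝ} {v : E} (hf : ∀ x, x ≠ 0 → HasFDerivAt f (f' x) x)
    (hc : HasCompactSupport f) {K : ℝ} (hK : ∀ x, |f x| ≤ K)
    (hi : Integrable fun x => f' x v) : ∫ x, f' x v = 0 := by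
  have : Nontrivial E := Module.nontrivial_of_finrank_pos (R := ℝ) (by omega)
  have hK0 : 0 ≤ K := (abs_nonneg _).trans (hK 0)
  have hfm : AEStronglyMeasurable f :=
    aestronglyMeasurable_of_continuousOn_compl_zero fun x hx =>
      (hf x hx).continuousAt.continuousWithinAt
  obtain ⟨L, hL0, hL⟩ := Real.smoothTransition.exists_deriv_bound
  -- The cutoff `g m` vanishes for `m|x| ≤ 1` and is one for `m²|x|² ≥ 2`; the squared norm keeps it
  -- smooth at the origin.
  set s : ℕ → E → ℝ := fun m x => (m : ℝ) ^ 2 * ‖x‖ ^ 2 - 1 with hs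
  set g : ℕ → E → ℝ := fun m x => Real.smoothTransition (s m x) with hg
  set g' : ℕ → E → E →L[ℝ] ℝ := fun m x =>
    deriv Real.smoothTransition (s m x) • ((m : ℝ) ^ 2 • (2 : ℝ) • innerSL ℝ x) with hg'
  have hdg : ∀ m x, HasFDerivAt (g m) (g' m x) x := by
    intro m x
    have h1 : HasFDerivAt (s m) ((m : ℝ) ^ 2 • (2 : ℝ) • innerSL ℝ x) x := by
      refine (((hasStrictFDerivAt_norm_sq x).hasFDerivAt.const_mul ((m : ℝ) ^ 2)).sub_const
        1).congr_fderiv ?_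
      ext w; simp
    exact ((Real.smoothTransition.contDiff (n := 1)).differentiable (by simp)
      (s m x)).hasDerivAt.comp_hasFDerivAt x h1
  -- The derivative grows like `m²|x|` but vanishes when `m²|x|² > 2`, so it is `O(1/|x|)` uniformly
  -- in `m`: an integrable majorant.
  have hg'b : ∀ m x, |g' m x v| ≤ 4 * L * ‖v‖ * ‖x‖⁻¹ := by
    intro m x
    have e : g' m x v = deriv Real.smoothTransition (s m x) * ((m : ℝ) ^ 2 * (2 * ⟪x, v⟫)) := rfl
    by_cases hx : 1 < s m x
    · rw [e, Real.smoothTransition.deriv_of_one_lt hx, zero_mul, abs_zero]; positivity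
    rcases eq_or_ne x 0 with rfl | hx0
    · rw [e]; simp
    have hx0' : 0 < ‖x‖ := norm_pos_iff.2 hx0
    rw [e, abs_mul, ← div_eq_mul_inv, le_div_iff₀ hx0', abs_mul, abs_mul, abs_two,
      abs_of_nonneg (sq_nonneg (m : ℝ))]
    have h2 : (m : ℝ) ^ 2 * ‖x‖ ^ 2 ≤ 2 := by simp only [hs] at hx; linarith
    calc |deriv Real.smoothTransition (s m x)| * ((m : ℝ) ^ 2 * (2 * |⟪x, v⟫|)) * ‖x‖
        ≤ L * ((m : ℝ) ^ 2 * (2 * (‖x‖ * ‖v‖))) * ‖x‖ := by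
          gcongr
          · exact hL _
          · exact abs_real_inner_le_norm x v
      _ = 2 * L * ‖v‖ * ((m : ℝ) ^ 2 * ‖x‖ ^ 2) := by ring
      _ ≤ 2 * L * ‖v‖ * 2 := by gcongr
      _ = 4 * L * ‖v‖ := by ring
  have hg'c : ∀ m, Continuous fun x => g' m x v := by
    intro m
    have : Continuous (deriv Real.smoothTransition) :=
      (Real.smoothTransition.contDiff (n := 1)).continuous_deriv (by simp)
    have e : (fun x => g' m x v) = fun x =>
      deriv Real.smoothTransition (s m x) * ((m : ℝ) ^ 2 * (2 * ⟪x, v⟫)) := rfl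
    rw [e]
    have : Continuous (s m) := by fun_prop
    fun_prop
  have hgc : ∀ m, Continuous (g m) := fun m =>
    Real.smoothTransition.continuous.comp (by fun_prop)
  have hgb : ∀ m x, ‖g m x‖ ≤ 1 := fun m x => by
    rw [Real.norm_of_nonneg (Real.smoothTransition.nonneg _)]
    exact Real.smoothTransition.le_one _
  have hfg'i : ∀ m, Integrable fun x => f x * g' m x v := fun m => by
    refine integrable_of_abs_le_mul_inv_norm hd (hfm.mul (hg'c m).aestronglyMeasurable)
      (hc.mul_right) (K := K * (4 * L * ‖v‖)) fun x _ => ?_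
    rw [abs_mul, mul_assoc]
    exact mul_le_mul (hK x) (hg'b m x) (abs_nonneg _) hK0
  have hfi : Integrable f := by
    obtain ⟨R, hR⟩ := hc.isCompact.isBounded.subset_ball 0
    rw [← integrableOn_iff_integrable_of_support_subset ((subset_tsupport f).trans hR)]
    exact Integrable.mono' (integrableOn_const (C := K) measure_ball_lt_top.ne) hfm.restrict
      (Eventually.of_forall hK)
  have ibp : ∀ m, ∫ x, f x * g' m x v = -∫ x, f' x v * g m x := by
    intro m
    refine integral_bilinear_hasFDerivAt_right_eq_neg_left_of_integrable
      (B := ContinuousLinearMap.mul ℝ ℝ) (f := f) (f' := f') (g := g m) (g' := g' m) ?_ ?_ ?_ ?_ ?_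
    · exact hi.mul_bdd (hgc m).aestronglyMeasurable (Eventually.of_forall (hgb m))
    · exact hfg'i m
    · exact hfi.mul_bdd (hgc m).aestronglyMeasurable (Eventually.of_forall (hgb m))
    -- Differentiability of `f` is needed only on the support of the cutoff, which avoids the
    -- origin.
    · intro x hx
      refine hf x ?_
      rintro rfl
      have h0 : g m =ᶠ[𝓝 0] 0 := by
        have hcs : ContinuousAt (s m) 0 := by
          have : Continuous (s m) := by fun_prop
          exact this.continuousAt
        have : s m 0 < 0 := by simp [hs]
        filter_upwards [hcs.eventually (Iio_mem_nhds this)] with y hy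
        exact Real.smoothTransition.zero_of_nonpos (le_of_lt hy)
      exact (notMem_tsupport_iff_eventuallyEq.2 h0) hx
    · exact fun x _ => hdg m x
  have ev : ∀ x : E, x ≠ 0 → ∀ᶠ m : ℕ in atTop, 1 < s m x := by
    intro x hx
    have hx0' : 0 < ‖x‖ := norm_pos_iff.2 hx
    have : Tendsto (fun m : ℕ => s m x) atTop atTop := by
      apply tendsto_atTop_add_const_right
      exact ((tendsto_pow_atTop two_ne_zero).comp
        tendsto_natCast_atTop_atTop).atTop_mul_const (by positivity)
    exact this.eventually_gt_atTop 1
  have ae0 : ∀ᵐ x : E, x ≠ 0 := by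
    simp [ae_iff]
  -- At each `x ≠ 0` the cutoff is eventually locally constant, so its contribution disappears by
  -- dominated convergence.
  have l1 : Tendsto (fun m => ∫ x, f x * g' m x v) atTop (𝓝 (∫ _ : E, (0 : ℝ))) := by
    obtain ⟨R, hR⟩ := hc.isCompact.isBounded.subset_ball 0
    refine tendsto_integral_of_dominated_convergence
      (fun x => (Metric.ball (0 : E) R).indicator (fun x => K * (4 * L * ‖v‖) * ‖x‖⁻¹) x)
      (fun m => (hfg'i m).aestronglyMeasurable) ?_ (fun m => Eventually.of_forall fun x => ?_) ?_
    · rw [integrable_indicator_iff measurableSet_ball]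
      exact (integrableOn_inv_norm_ball hd R).const_mul _
    · by_cases hx : x ∈ Metric.ball (0 : E) R
      · rw [Set.indicator_of_mem hx, Real.norm_eq_abs, abs_mul, mul_assoc]
        exact mul_le_mul (hK x) (hg'b m x) (abs_nonneg _) hK0
      · have : f x = 0 := image_eq_zero_of_notMem_tsupport fun h => hx (hR h)
        rw [Set.indicator_of_notMem hx, this]; simp
    · filter_upwards [ae0] with x hx
      refine tendsto_const_nhds.congr' ?_
      filter_upwards [ev x hx] with m hm
      have e : g' m x v = deriv Real.smoothTransition (s m x) * ((m : ℝ) ^ 2 * (2 * ⟪x, v⟫)) := rfl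
      rw [e, Real.smoothTransition.deriv_of_one_lt hm]; ring
  have l2 : Tendsto (fun m => ∫ x, f' x v * g m x) atTop (𝓝 (∫ x, f' x v)) := by
    refine tendsto_integral_of_dominated_convergence (fun x => ‖f' x v‖)
      (fun m => hi.aestronglyMeasurable.mul (hgc m).aestronglyMeasurable) hi.norm
      (fun m => Eventually.of_forall fun x => ?_) ?_
    · rw [norm_mul]; exact mul_le_of_le_one_right (norm_nonneg _) (hgb m x)
    · filter_upwards [ae0] with x hx
      refine tendsto_const_nhds.congr' ?_
      filter_upwards [ev x hx] with m hm
      change _ = f' x v * Real.smoothTransition (s m x)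
      rw [Real.smoothTransition.one_of_one_le hm.le, mul_one]
  have l3 := tendsto_nhds_unique l1 (by simpa only [ibp] using l2.neg)
  simpa using l3.symm

end Singular

/-! ### A divergence theorem for fields with a conical singularity -/

section Conical

variable {E : Type*} [NormedAddCommGroup E] [InnerProductSpace ℝ E]

/-- Bounded functions which are `C¹` away from the origin, with derivative of size `O(1/|x|)`. -/
structure ConicalC1 {F : Type*} [NormedAddCommGroup F] [NormedSpace ℝ F] (f : E → F) : Prop where
  contDiffOn : ContDiffOn ℝ 1 f {0}ᶜ
  exists_bound : ∃ K, ∀ x, ‖f x‖ ≤ K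
  exists_fderiv_bound : ∃ K, ∀ x, x ≠ 0 → ‖fderiv ℝ f x‖ ≤ K * ‖x‖⁻¹

namespace ConicalC1

variable {F : Type*} [NormedAddCommGroup F] [InnerProductSpace ℝ F]

lemma differentiableAt {f : E → F} (hf : ConicalC1 f) {x : E} (hx : x ≠ 0) :
    DifferentiableAt ℝ f x :=
  (hf.contDiffOn.differentiableOn (by simp)).differentiableAt
    (isOpen_compl_singleton.mem_nhds hx)

lemma continuousOn_fderiv {f : E → F} (hf : ConicalC1 f) :
    ContinuousOn (fderiv ℝ f) {0}ᶜ :=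
  hf.contDiffOn.continuousOn_fderiv_of_isOpen isOpen_compl_singleton le_rfl

lemma inner {f g : E → F} (hf : ConicalC1 f) (hg : ConicalC1 g) :
    ConicalC1 fun x => ⟪f x, g x⟫ := by
  obtain ⟨K, hK⟩ := hf.exists_bound
  obtain ⟨K', hK'⟩ := hf.exists_fderiv_bound
  obtain ⟨M, hM⟩ := hg.exists_bound
  obtain ⟨M', hM'⟩ := hg.exists_fderiv_bound
  have hK0 : 0 ≤ K := (norm_nonneg _).trans (hK 0)
  have hM0 : 0 ≤ M := (norm_nonneg _).trans (hM 0)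
  refine ⟨hf.contDiffOn.inner ℝ hg.contDiffOn, ⟨K * M, fun x => ?_⟩, ⟨K * M' + K' * M, ?_⟩⟩
  · exact (norm_inner_le_norm _ _).trans (mul_le_mul (hK x) (hM x) (norm_nonneg _) hK0)
  · intro x hx
    have hb : 0 ≤ (K * M' + K' * M) * ‖x‖⁻¹ := by
      rw [add_mul, mul_assoc, mul_right_comm]
      exact add_nonneg (mul_nonneg hK0 ((norm_nonneg _).trans (hM' x hx)))
        (mul_nonneg ((norm_nonneg _).trans (hK' x hx)) hM0)
    refine ContinuousLinearMap.opNorm_le_bound _ hb fun v => ?_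
    rw [fderiv_inner_apply ℝ (hf.differentiableAt hx) (hg.differentiableAt hx)]
    calc ‖⟪f x, fderiv ℝ g x v⟫ + ⟪fderiv ℝ f x v, g x⟫‖
        ≤ ‖f x‖ * (‖fderiv ℝ g x‖ * ‖v‖) + ‖fderiv ℝ f x‖ * ‖v‖ * ‖g x‖ := by
          refine (norm_add_le _ _).trans (add_le_add ?_ ?_)
          · exact (norm_inner_le_norm _ _).trans
              (mul_le_mul_of_nonneg_left (ContinuousLinearMap.le_opNorm _ _) (norm_nonneg _))
          · exact (norm_inner_le_norm _ _).trans
              (mul_le_mul_of_nonneg_right (ContinuousLinearMap.le_opNorm _ _) (norm_nonneg _))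
      _ ≤ K * (M' * ‖x‖⁻¹ * ‖v‖) + K' * ‖x‖⁻¹ * ‖v‖ * M := by
          gcongr
          · exact hK x
          · exact hM' x hx
          · exact mul_nonneg ((norm_nonneg _).trans (hK' x hx)) (norm_nonneg _)
          · exact hK' x hx
          · exact hM x
      _ = (K * M' + K' * M) * ‖x‖⁻¹ * ‖v‖ := by ring

lemma mul {f g : E → ℝ} (hf : ConicalC1 f) (hg : ConicalC1 g) :
    ConicalC1 fun x => f x * g x := by
  simpa [mul_comm] using hf.inner hg

lemma const (c : F) : ConicalC1 fun _ : E => c :=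
  ⟨contDiffOn_const, ⟨‖c‖, fun _ => le_rfl⟩, ⟨0, fun x _ => by simp⟩⟩

lemma of_contDiff_of_hasCompactSupport {f : E → F} (hf : ContDiff ℝ 1 f)
    (hc : HasCompactSupport f) : ConicalC1 f := by
  refine ⟨hf.contDiffOn, hf.continuous.bounded_above_of_compact_support hc, ?_⟩
  -- A bound on `|x| |Df|` is the required `O(1/|x|)` estimate.
  have h1 : Continuous fun x => ‖x‖ • fderiv ℝ f x :=
    continuous_norm.smul (hf.continuous_fderiv (by simp))
  obtain ⟨K, hK⟩ := h1.bounded_above_of_compact_support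
    ((hc.fderiv (𝕜 := ℝ)).mono fun x hx h => hx (by simp [h]))
  refine ⟨K, fun x hx => ?_⟩
  have hx' : 0 < ‖x‖ := norm_pos_iff.2 hx
  rw [← div_eq_mul_inv, le_div_iff₀ hx', mul_comm]
  simpa [norm_smul] using hK x

/-- The model example: homogeneous of degree zero, with derivative of degree `-1`. The class is
designed to contain this field and to be stable under products. -/
lemma norm_inv_smul : ConicalC1 fun x : E => ‖x‖⁻¹ • x := by
  refine ⟨fun x hx => ?_, ⟨1, fun x => ?_⟩, ⟨2, fun x hx => ?_⟩⟩
  · have hx' : x ≠ 0 := hx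
    exact (((contDiffAt_norm ℝ hx').inv (norm_ne_zero_iff.2 hx')).smul
      contDiffAt_id).contDiffWithinAt
  · rw [norm_smul, norm_inv, norm_norm]
    exact inv_mul_le_one
  · rw [(hasFDerivAt_norm_inv_smul hx).fderiv]
    have hx' : ‖x‖ ≠ 0 := norm_ne_zero_iff.2 hx
    have h1 : ‖‖x‖⁻¹ • x‖ = 1 := by rw [norm_smul, norm_inv, norm_norm, inv_mul_cancel₀ hx']
    rw [norm_smul, norm_inv, norm_norm, mul_comm]
    gcongr
    refine (norm_sub_le _ _).trans ?_
    have h2 : ‖(innerSL ℝ (‖x‖⁻¹ • x)).smulRight (‖x‖⁻¹ • x)‖ = 1 := by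
      rw [ContinuousLinearMap.norm_smulRight_apply, innerSL_apply_norm, h1, one_mul]
    rw [h2]
    linarith [ContinuousLinearMap.norm_id_le (𝕜 := ℝ) (E := E)]

end ConicalC1

variable [FiniteDimensional ℝ E] [MeasurableSpace E] [BorelSpace E]

/-- The divergence theorem for `φ X`, for functions of compact support with a conical singularity
at the origin. -/
lemma integral_divergence_conical {ι : Type*} [Fintype ι] (b : OrthonormalBasis ι ℝ E)
    (hd : 2 ≤ Module.finrank ℝ E) {φ : E → ℝ} {X : E → E} (hφ : ConicalC1 φ) (hX : ConicalC1 X)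
    (hc : HasCompactSupport φ) :
    Integrable (fun x => fderiv ℝ φ x (X x) + φ x * ∑ i, ⟪fderiv ℝ X x (b i), b i⟫) ∧
      ∫ x, (fderiv ℝ φ x (X x) + φ x * ∑ i, ⟪fderiv ℝ X x (b i), b i⟫) = 0 := by
  have : Nontrivial E := Module.nontrivial_of_finrank_pos (R := ℝ) (by omega)
  -- Each component is differentiated in its own direction; off the origin the sum is the divergence
  -- of `φ X`.
  set f : ι → E → ℝ := fun i x => φ x * ⟪X x, b i⟫ with hf
  have hfC : ∀ i, ConicalC1 (f i) := fun i => hφ.mul (hX.inner (ConicalC1.const (b i)))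
  have hfc : ∀ i, HasCompactSupport (f i) := fun i => hc.mul_right
  have hint : ∀ i, Integrable fun x => fderiv ℝ (f i) x (b i) := by
    intro i
    obtain ⟨K, hK⟩ := (hfC i).exists_fderiv_bound
    refine integrable_of_abs_le_mul_inv_norm hd (K := K)
      (aestronglyMeasurable_of_continuousOn_compl_zero
        ((hfC i).continuousOn_fderiv.clm_apply continuousOn_const))
      ((hfc i).fderiv_apply (𝕜 := ℝ) (b i)) fun x hx => ?_
    refine ((fderiv ℝ (f i) x).le_opNorm (b i)).trans ?_
    rw [b.norm_eq_one, mul_one]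
    exact hK x hx
  have hzero : ∀ i, ∫ x, fderiv ℝ (f i) x (b i) = 0 := by
    intro i
    obtain ⟨K, hK⟩ := (hfC i).exists_bound
    exact integral_eq_zero_of_hasFDerivAt_compl_zero hd
      (fun x hx => ((hfC i).differentiableAt hx).hasFDerivAt) (hfc i) hK (hint i)
  have hae : (fun x => ∑ i, fderiv ℝ (f i) x (b i)) =ᵐ[volume]
      fun x => fderiv ℝ φ x (X x) + φ x * ∑ i, ⟪fderiv ℝ X x (b i), b i⟫ := by
    filter_upwards [show ∀ᵐ x : E, x ≠ 0 by simp [ae_iff]] with x hx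
    have h1 : ∀ i, fderiv ℝ (f i) x (b i) =
        ⟪b i, X x⟫ * fderiv ℝ φ x (b i) + φ x * ⟪fderiv ℝ X x (b i), b i⟫ := by
      intro i
      rw [hf, fderiv_fun_mul (hφ.differentiableAt hx)
        ((hX.inner (ConicalC1.const (b i))).differentiableAt hx)]
      change φ x * fderiv ℝ (fun y => ⟪X y, b i⟫) x (b i) + ⟪X x, b i⟫ * fderiv ℝ φ x (b i) = _
      rw [fderiv_inner_apply ℝ (hX.differentiableAt hx) (differentiableAt_const _),
        real_inner_comm (X x)]
      simp
      ring
    have h2 : fderiv ℝ φ x (X x) = ∑ i, ⟪b i, X x⟫ * fderiv ℝ φ x (b i) := by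
      conv_lhs => rw [← b.sum_repr' (X x), map_sum]
      simp
    rw [h2, Finset.mul_sum, ← Finset.sum_add_distrib]
    exact Finset.sum_congr rfl fun i _ => h1 i
  refine ⟨(integrable_finsetSum _ fun i _ => hint i).congr hae, ?_⟩
  rw [← integral_congr_ae hae, integral_finsetSum _ fun i _ => hint i]
  simp [hzero]

end Conical

/-! ### Equality of the `L²` norms of Hessian and Laplacian -/

section Identities

variable {E : Type*} [NormedAddCommGroup E] [InnerProductSpace ℝ E] [FiniteDimensional ℝ E]
  [MeasurableSpace E] [BorelSpace E]

/-- Moving the derivative off `g` leaves the second derivative of `f` in the directions `v, w`,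
which is symmetric in them. -/
lemma integral_fderiv_mul_fderiv_comm {f g : E → ℝ} (hf : ContDiff ℝ ∞ f)
    (hfc : HasCompactSupport f) (hg : ContDiff ℝ ∞ g) (v w : E) :
    ∫ x, fderiv ℝ f x v * fderiv ℝ g x w = ∫ x, fderiv ℝ f x w * fderiv ℝ g x v := by
  have hd : ∀ z, ContDiff ℝ ∞ fun x => fderiv ℝ f x z := fun z =>
    (hf.fderiv_right (m := ∞) (by norm_num)).clm_apply contDiff_const
  have hdg : ∀ z, ContDiff ℝ ∞ fun x => fderiv ℝ g x z := fun z =>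
    (hg.fderiv_right (m := ∞) (by norm_num)).clm_apply contDiff_const
  have hdd : ∀ z z', ContDiff ℝ ∞ fun x => fderiv ℝ (fun y => fderiv ℝ f y z) x z' := fun z z' =>
    ((hd z).fderiv_right (m := ∞) (by norm_num)).clm_apply contDiff_const
  have hc : ∀ z, HasCompactSupport fun x => fderiv ℝ f x z := fun z => hfc.fderiv_apply ℝ z
  have hcc : ∀ z z', HasCompactSupport fun x => fderiv ℝ (fun y => fderiv ℝ f y z) x z' :=
    fun z z' => (hc z).fderiv_apply ℝ z'
  have key : ∀ z z', ∫ x, fderiv ℝ f x z * fderiv ℝ g x z' =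
      -∫ x, fderiv ℝ (fun y => fderiv ℝ f y z) x z' * g x := fun z z' =>
    integral_mul_fderiv_eq_neg_fderiv_mul_of_integrable
      (((hdd z z').continuous.mul hg.continuous).integrable_of_hasCompactSupport
        (hcc z z').mul_right)
      (((hd z).continuous.mul (hdg z').continuous).integrable_of_hasCompactSupport
        (hc z).mul_right)
      (((hd z).continuous.mul hg.continuous).integrable_of_hasCompactSupport (hc z).mul_right)
      (fun x _ => (hd z).differentiable (by simp) x) (fun x _ => hg.differentiable (by simp) x)
  rw [key v w, key w v]
  congr 2 with x
  have hs : IsSymmSndFDerivAt ℝ f x :=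
    hf.contDiffAt.isSymmSndFDerivAt (by simpa using WithTop.coe_le_coe.2 (le_top : (2 : ℕ∞) ≤ ⊤))
  have h3 : DifferentiableAt ℝ (fderiv ℝ f) x :=
    (hf.fderiv_right (m := ∞) (by norm_num)).differentiable (by simp) x
  rw [fderiv_clm_apply h3 (differentiableAt_const v), fderiv_clm_apply h3 (differentiableAt_const w)]
  simp [hs v w]

/-- The Laplacian and the Hessian of a test function have the same `L²` norm. -/
lemma integral_laplacian_sq {ι : Type*} [Fintype ι] (b : OrthonormalBasis ι ℝ E) {u : E → ℝ}
    (hu : ContDiff ℝ ∞ u) (hc : HasCompactSupport u) :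
    ∫ x, Laplacian.laplacian u x ^ 2 = ∫ x, ∑ i, ‖fderiv ℝ (gradient u) x (b i)‖ ^ 2 := by
  have hH := continuous_fderiv_gradient hu
  have hHc : HasCompactSupport (fderiv ℝ (gradient u)) := hc.gradient'.fderiv (𝕜 := ℝ)
  have hint : ∀ v w v' w' : E, Integrable fun x =>
      ⟪fderiv ℝ (gradient u) x v, w⟫ * ⟪fderiv ℝ (gradient u) x v', w'⟫ := by
    intro v w v' w'
    refine Continuous.integrable_of_hasCompactSupport (by fun_prop) ?_
    exact hHc.mono fun x hx h => hx (by simp [h])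
  have hL : ∀ x, Laplacian.laplacian u x ^ 2 = ∑ i, ∑ j,
      ⟪fderiv ℝ (gradient u) x (b i), b i⟫ * ⟪fderiv ℝ (gradient u) x (b j), b j⟫ := by
    intro x
    rw [laplacian_eq_sum_inner b hu, sq, Finset.sum_mul_sum]
  -- By symmetry of the Hessian the indices can be arranged so that, with `f = ∂_i u` and `g = ∂_j
  -- u`, the two double sums differ by exchanging the directions of differentiation.
  have hR : ∀ x, ∑ i, ‖fderiv ℝ (gradient u) x (b i)‖ ^ 2 = ∑ i, ∑ j,
      ⟪fderiv ℝ (gradient u) x (b j), b i⟫ * ⟪fderiv ℝ (gradient u) x (b i), b j⟫ := by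
    intro x
    refine Finset.sum_congr rfl fun i _ => ?_
    rw [← b.sum_sq_norm_inner_left]
    refine Finset.sum_congr rfl fun j _ => ?_
    have := isSymmetric_fderiv_gradient hu x (b j) (b i)
    simp only [ContinuousLinearMap.coe_coe] at this
    rw [this, Real.norm_eq_abs, sq_abs, real_inner_comm]
    ring
  simp_rw [hL, hR]
  rw [integral_finsetSum _ fun i _ => integrable_finsetSum _ fun j _ => hint _ _ _ _,
    integral_finsetSum _ fun i _ => integrable_finsetSum _ fun j _ => hint _ _ _ _]
  refine Finset.sum_congr rfl fun i _ => ?_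
  rw [integral_finsetSum _ fun j _ => hint _ _ _ _, integral_finsetSum _ fun j _ => hint _ _ _ _]
  refine Finset.sum_congr rfl fun j _ => ?_
  simp_rw [inner_fderiv_gradient_eq hu]
  refine integral_fderiv_mul_fderiv_comm ?_ (hc.fderiv_apply ℝ _) ?_ _ _
  · exact (hu.fderiv_right (m := ∞) (by norm_num)).clm_apply contDiff_const
  · exact (hu.fderiv_right (m := ∞) (by norm_num)).clm_apply contDiff_const

end Identities

/-! ### The refined inequality for test functions -/

section MainInequality

variable {E : Type*} [NormedAddCommGroup E] [InnerProductSpace ℝ E]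

/-- The density `(a |V|² + c (V · x/|x|)²) / |x|`. -/
noncomputable def radialDensity (a c : ℝ) (x V : E) : ℝ :=
  (a * ‖V‖ ^ 2 + c * ⟪V, ‖x‖⁻¹ • x⟫ ^ 2) * ‖x‖⁻¹

lemma radialDensity_nonneg {a c : ℝ} (ha : 0 ≤ a) (hc : 0 ≤ c) (x V : E) :
    0 ≤ radialDensity a c x V := by
  unfold radialDensity; positivity

variable [FiniteDimensional ℝ E] [MeasurableSpace E] [BorelSpace E]

lemma integrable_radialDensity (hd : 2 ≤ Module.finrank ℝ E) (a c : ℝ) {V : E → E}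
    (hV : ContDiff ℝ 1 V) (hVc : HasCompactSupport V) :
    Integrable fun x => radialDensity a c x (V x) := by
  have : Nontrivial E := Module.nontrivial_of_finrank_pos (R := ℝ) (by omega)
  have hC := ConicalC1.of_contDiff_of_hasCompactSupport hV hVc
  have h1 : ConicalC1 fun x => ⟪V x, V x⟫ := hC.inner hC
  have h2 : ConicalC1 fun x : E => ⟪V x, ‖x‖⁻¹ • x⟫ := hC.inner ConicalC1.norm_inv_smul
  obtain ⟨K, hK⟩ := h1.exists_bound
  obtain ⟨M, hM⟩ := (h2.mul h2).exists_bound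
  have hcont : ContinuousOn (fun x => radialDensity a c x (V x)) {0}ᶜ := by
    have e : (fun x => radialDensity a c x (V x)) = fun x =>
        (a * ⟪V x, V x⟫ + c * (⟪V x, ‖x‖⁻¹ • x⟫ * ⟪V x, ‖x‖⁻¹ • x⟫)) * ‖x‖⁻¹ := by
      ext x; rw [radialDensity, real_inner_self_eq_norm_sq, sq ⟪V x, _⟫]
    rw [e]
    refine ContinuousOn.mul ?_ (continuousOn_id.norm.inv₀ fun x hx => norm_ne_zero_iff.2 hx)
    exact (h1.contDiffOn.continuousOn.const_smul a).add
      ((h2.mul h2).contDiffOn.continuousOn.const_smul c)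
  refine integrable_of_abs_le_mul_inv_norm hd (K := |a| * K + |c| * M)
    (aestronglyMeasurable_of_continuousOn_compl_zero hcont) ?_ fun x _ => ?_
  · exact hVc.mono fun x hx h => hx (by simp [radialDensity, h])
  · rw [radialDensity, abs_mul, abs_inv, abs_norm]
    gcongr
    refine (abs_add_le _ _).trans ?_
    rw [abs_mul, abs_mul]
    gcongr
    · simpa using hK x
    · simpa [sq] using hM x

/-- The refined second order Hydrogen inequality for test functions, in dimension `n + 1 ≥ 2`. -/
lemma sq_integral_radialDensity_gradient_le (hd : 2 ≤ Module.finrank ℝ E) {n : ℝ}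
    (hn : (Module.finrank ℝ E : ℝ) = n + 1) {u : E → ℝ} (hu : ContDiff ℝ ∞ u)
    (hc : HasCompactSupport u) :
    (∫ x, radialDensity (n + 2 - 2 / n) (2 / n) x (gradient u x)) ^ 2 ≤
      4 * (∫ x, Laplacian.laplacian u x ^ 2) * ∫ x, ‖gradient u x‖ ^ 2 := by
  have : Nontrivial E := Module.nontrivial_of_finrank_pos (R := ℝ) (by omega)
  have hn1 : 1 ≤ n := by
    have : (2 : ℝ) ≤ Module.finrank ℝ E := by exact_mod_cast hd
    linarith
  have hn0 : 0 < n := by linarith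
  set b := stdOrthonormalBasis ℝ E
  have hcard : (Fintype.card (Fin (Module.finrank ℝ E)) : ℝ) = n + 1 := by
    rw [Fintype.card_fin, hn]
  set V := gradient u with hVdef
  have hV : ContDiff ℝ ∞ V := hu.gradient_infty
  have hV1 : ContDiff ℝ 1 V := hV.of_le (by simp)
  have hVc : HasCompactSupport V := hc.gradient'
  have hVd : ∀ x, DifferentiableAt ℝ V x := fun x => hV1.differentiable (by simp) x
  have hC := ConicalC1.of_contDiff_of_hasCompactSupport hV1 hVc
  have hξ : ConicalC1 fun x : E => ‖x‖⁻¹ • x := ConicalC1.norm_inv_smul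
  -- Off the origin `J1` is the divergence of `|V|² ξ` and `J3` that of `(V·ξ) V`.
  obtain ⟨J1, hJ1, i1, z1⟩ : ∃ J : E → ℝ, (∀ x, J x = fderiv ℝ (fun y => ⟪V y, V y⟫) x (‖x‖⁻¹ • x)
      + ⟪V x, V x⟫ * ∑ i, ⟪fderiv ℝ (fun y : E => ‖y‖⁻¹ • y) x (b i), b i⟫) ∧
      Integrable J ∧ ∫ x, J x = 0 :=
    ⟨_, fun _ => rfl, integral_divergence_conical b hd (hC.inner hC) hξ
      (hVc.mono fun x hx h => hx (by simp [h]))⟩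
  obtain ⟨J3, hJ3, i3, z3⟩ : ∃ J : E → ℝ, (∀ x, J x = fderiv ℝ (fun y => ⟪V y, ‖y‖⁻¹ • y⟫) x (V x)
      + ⟪V x, ‖x‖⁻¹ • x⟫ * ∑ i, ⟪fderiv ℝ V x (b i), b i⟫) ∧ Integrable J ∧ ∫ x, J x = 0 :=
    ⟨_, fun _ => rfl, integral_divergence_conical b hd (hC.inner hξ) hC
      (hVc.mono fun x hx h => hx (by simp [h]))⟩
  have iW := integrable_radialDensity hd (n + 2 - 2 / n) (2 / n) hV1 hVc
  have hH := continuous_fderiv_gradient hu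
  have hHc : HasCompactSupport (fderiv ℝ V) := hVc.fderiv (𝕜 := ℝ)
  have iH : Integrable fun x => ∑ i, ‖fderiv ℝ V x (b i)‖ ^ 2 :=
    Continuous.integrable_of_hasCompactSupport (by fun_prop)
      (hHc.mono fun x hx h => hx (by simp [h]))
  have iL : Integrable fun x => (∑ i, ⟪fderiv ℝ V x (b i), b i⟫) ^ 2 :=
    Continuous.integrable_of_hasCompactSupport (by fun_prop)
      (hHc.mono fun x hx h => hx (by simp [h]))
  have iV : Integrable fun x => ‖V x‖ ^ 2 :=
    Continuous.integrable_of_hasCompactSupport (by have := hV.continuous; fun_prop)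
      (hVc.mono fun x hx h => hx (by simp [h]))
  set A := ∫ x, Laplacian.laplacian u x ^ 2 with hA
  -- Both second-order terms integrate to `A`, so their weights `(n + 1)/n` and `-1/n` combine to
  -- exactly `A`.
  have hA1 : ∫ x, ∑ i, ‖fderiv ℝ V x (b i)‖ ^ 2 = A := (integral_laplacian_sq b hu hc).symm
  have hA2 : ∫ x, (∑ i, ⟪fderiv ℝ V x (b i), b i⟫) ^ 2 = A := by
    rw [hA]; congr 1; ext x; rw [laplacian_eq_sum_inner b hu]
  have hquad : ∀ t : ℝ, 0 ≤ (∫ x, ‖V x‖ ^ 2) * (t * t)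
      + (-∫ x, radialDensity (n + 2 - 2 / n) (2 / n) x (V x)) * t + A := by
    intro t
    -- The weights of `J1` and `J3` match the Hessian cross terms, since `2(n + 2)/n - 2/n = 2(n +
    -- 1)/n`. The zeroth-order remainder is then precisely the weighted density, which is
    -- subtracted.
    have hpos : 0 ≤ ∫ x, (((n + 1) / n * ∑ i, ‖fderiv ℝ V x (b i)‖ ^ 2
        - 1 / n * (∑ i, ⟪fderiv ℝ V x (b i), b i⟫) ^ 2) + t ^ 2 * ‖V x‖ ^ 2
        + t * ((n + 2) / n * J1 x - 2 / n * J3 x)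
        - t * radialDensity (n + 2 - 2 / n) (2 / n) x (V x)) := by
      refine integral_nonneg_of_ae ?_
      filter_upwards [show ∀ᵐ x : E, x ≠ 0 by simp [ae_iff]] with x hx
      have hx' : ‖x‖ ≠ 0 := norm_ne_zero_iff.2 hx
      set ξ : E := ‖x‖⁻¹ • x with hξdef
      have hξ1 : ‖ξ‖ = 1 := by rw [hξdef, norm_smul, norm_inv, norm_norm, inv_mul_cancel₀ hx']
      have hξξ : ⟪ξ, ξ⟫ = 1 := by rw [real_inner_self_eq_norm_sq, hξ1]; norm_num
      have hsymm := isSymmetric_fderiv_gradient hu x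
      have hq := hessian_quadratic_form_nonneg b hsymm hξ1 (V x) t hn1 hcard
      have hDξ : ∀ v, fderiv ℝ (fun y : E => ‖y‖⁻¹ • y) x v = ‖x‖⁻¹ • (v - ⟪ξ, v⟫ • ξ) := by
        intro v; rw [(hasFDerivAt_norm_inv_smul hx).fderiv]; rfl
      have hdiv : ∑ i, ⟪fderiv ℝ (fun y : E => ‖y‖⁻¹ • y) x (b i), b i⟫ = n * ‖x‖⁻¹ := by
        have : ∀ i, ⟪fderiv ℝ (fun y : E => ‖y‖⁻¹ • y) x (b i), b i⟫
            = ‖x‖⁻¹ * (1 - ⟪ξ, b i⟫ * ⟪b i, ξ⟫) := by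
          intro i
          rw [hDξ, real_inner_smul_left, inner_sub_left, real_inner_smul_left,
            real_inner_self_eq_norm_sq, b.norm_eq_one, real_inner_comm (b i) ξ]
          norm_num
        simp_rw [this]
        rw [← Finset.mul_sum, Finset.sum_sub_distrib, b.sum_inner_mul_inner, hξξ]
        simp only [Finset.sum_const, Finset.card_univ, nsmul_eq_mul, mul_one, hcard]
        ring
      have e1 : J1 x = 2 * ⟪fderiv ℝ V x ξ, V x⟫ + ‖V x‖ ^ 2 * (n * ‖x‖⁻¹) := by
        rw [hJ1, hdiv, fderiv_inner_apply ℝ (hVd x) (hVd x), real_inner_comm,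
          real_inner_self_eq_norm_sq]
        ring
      have e3 : J3 x = ⟪fderiv ℝ V x ξ, V x⟫ + ‖x‖⁻¹ * (‖V x‖ ^ 2 - ⟪V x, ξ⟫ ^ 2)
          + ⟪V x, ξ⟫ * ∑ i, ⟪fderiv ℝ V x (b i), b i⟫ := by
        rw [hJ3, fderiv_inner_apply ℝ (hVd x) (hξ.differentiableAt hx), hDξ, real_inner_smul_right,
          inner_sub_right, real_inner_smul_right, real_inner_self_eq_norm_sq]
        have := hsymm (V x) ξ
        simp only [ContinuousLinearMap.coe_coe] at this
        rw [← hξdef, this, real_inner_comm (V x) ξ, real_inner_comm (fderiv ℝ V x ξ) (V x)]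
        ring
      simp only [ContinuousLinearMap.coe_coe] at hq
      rw [Pi.zero_apply, e1, e3, radialDensity, ← hξdef]
      refine hq.trans_eq ?_
      field_simp
      ring
    have s1 : Integrable fun x => (n + 1) / n * ∑ i, ‖fderiv ℝ V x (b i)‖ ^ 2
        - 1 / n * (∑ i, ⟪fderiv ℝ V x (b i), b i⟫) ^ 2 :=
      (iH.const_mul _).sub (iL.const_mul _)
    have s2 : Integrable fun x => t * ((n + 2) / n * J1 x - 2 / n * J3 x) :=
      ((i1.const_mul _).sub (i3.const_mul _)).const_mul t
    have s3 : Integrable fun x => (n + 1) / n * ∑ i, ‖fderiv ℝ V x (b i)‖ ^ 2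
        - 1 / n * (∑ i, ⟪fderiv ℝ V x (b i), b i⟫) ^ 2 + t ^ 2 * ‖V x‖ ^ 2 :=
      s1.add (iV.const_mul _)
    have s4 : Integrable fun x => (n + 1) / n * ∑ i, ‖fderiv ℝ V x (b i)‖ ^ 2
        - 1 / n * (∑ i, ⟪fderiv ℝ V x (b i), b i⟫) ^ 2 + t ^ 2 * ‖V x‖ ^ 2
        + t * ((n + 2) / n * J1 x - 2 / n * J3 x) := s3.add s2
    rw [integral_sub s4 (iW.const_mul t), integral_add s3 s2, integral_add s1 (iV.const_mul _),
      integral_sub (iH.const_mul _) (iL.const_mul _), integral_const_mul, integral_const_mul,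
      integral_const_mul, integral_const_mul, integral_const_mul,
      integral_sub (i1.const_mul _) (i3.const_mul _), integral_const_mul, integral_const_mul,
      z1, z3, hA1, hA2] at hpos
    refine hpos.trans_eq ?_
    field_simp
    ring
  have := discrim_le_zero hquad
  rw [discrim] at this
  nlinarith [this]

end MainInequality

/-! ### Passage from test functions to the Sobolev closure -/

section Fatou

lemma integral_norm_sq_eq_norm_toLp_sq {α F : Type*} [MeasurableSpace α] {μ : Measure α}
    [NormedAddCommGroup F] {f : α → F} (hf : MemLp f 2 μ) :
    ∫ x, ‖f x‖ ^ 2 ∂μ = ‖hf.toLp f‖ ^ 2 := by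
  rw [Lp.norm_toLp, hf.eLpNorm_eq_integral_rpow_norm two_ne_zero ENNReal.ofNat_ne_top,
    ENNReal.toReal_ofReal (by positivity)]
  simp only [ENNReal.toReal_ofNat, Real.rpow_ofNat]
  rw [← Real.rpow_natCast, ← Real.rpow_mul (integral_nonneg fun x => by positivity)]
  norm_num

lemma tendsto_integral_norm_sq_of_tendsto_eLpNorm {α F : Type*} [MeasurableSpace α] {μ : Measure α}
    [NormedAddCommGroup F] {f : ℕ → α → F} {g : α → F} (hf : ∀ n, MemLp (f n) 2 μ)
    (hg : MemLp g 2 μ) (h : Tendsto (fun n => eLpNorm (fun x => f n x - g x) 2 μ) atTop (𝓝 0)) :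
    Tendsto (fun n => ∫ x, ‖f n x‖ ^ 2 ∂μ) atTop (𝓝 (∫ x, ‖g x‖ ^ 2 ∂μ)) := by
  have h1 := (Lp.tendsto_Lp_iff_tendsto_eLpNorm'' f hf g hg).2 h
  simp_rw [fun n => integral_norm_sq_eq_norm_toLp_sq (hf n), integral_norm_sq_eq_norm_toLp_sq hg]
  exact h1.norm.pow 2

variable {N : ℕ}

lemma IsTestFunction.memLp_gradient {u : EuclideanSpace ℝ (Fin N) → ℝ} (hu : IsTestFunction u) :
    MemLp (gradient u) 2 volume :=
  hu.1.gradient_infty.continuous.memLp_of_hasCompactSupport hu.2.gradient'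

lemma IsTestFunction.continuous_laplacian {u : EuclideanSpace ℝ (Fin N) → ℝ}
    (hu : IsTestFunction u) : Continuous (Laplacian.laplacian u) := by
  have h := funext fun x => laplacian_eq_sum_inner (EuclideanSpace.basisFun (Fin N) ℝ) hu.1 x
  rw [h]
  have := continuous_fderiv_gradient hu.1
  fun_prop

lemma IsTestFunction.hasCompactSupport_laplacian {u : EuclideanSpace ℝ (Fin N) → ℝ}
    (hu : IsTestFunction u) : HasCompactSupport (Laplacian.laplacian u) := by
  have h := funext fun x => laplacian_eq_sum_inner (EuclideanSpace.basisFun (Fin N) ℝ) hu.1 x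
  rw [h]
  exact (hu.2.gradient'.fderiv (𝕜 := ℝ)).mono fun x hx h => hx (by simp [h])

lemma IsTestFunction.memLp_laplacian {u : EuclideanSpace ℝ (Fin N) → ℝ} (hu : IsTestFunction u) :
    MemLp (Laplacian.laplacian u) 2 volume :=
  hu.continuous_laplacian.memLp_of_hasCompactSupport hu.hasCompactSupport_laplacian

lemma IsTestFunction.memH2 {u : EuclideanSpace ℝ (Fin N) → ℝ} (hu : IsTestFunction u) :
    MemH2 u (gradient u) (Laplacian.laplacian u) where
  locallyIntegrable := hu.1.continuous.locallyIntegrable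
  memLp_grad := hu.memLp_gradient
  memLp_laplacian := hu.memLp_laplacian
  exists_approx := ⟨fun _ => u, fun _ => hu, by simp, by simp, by simp⟩

/-- Inequalities for test functions with a density `radialDensity a c` pass to `H²_{0,0}`. -/
lemma MemH2.sq_integral_radialDensity_le {a c K : ℝ} (ha : 0 ≤ a) (hc : 0 ≤ c) (hK : 0 ≤ K)
    (htest : ∀ φ : EuclideanSpace ℝ (Fin N) → ℝ, IsTestFunction φ →
      Integrable (fun x => radialDensity a c x (gradient φ x)) ∧
      (∫ x, radialDensity a c x (gradient φ x)) ^ 2 ≤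
        K * ((∫ x, Laplacian.laplacian φ x ^ 2) * ∫ x, ‖gradient φ x‖ ^ 2))
    {u : EuclideanSpace ℝ (Fin N) → ℝ}
    {G : EuclideanSpace ℝ (Fin N) → EuclideanSpace ℝ (Fin N)}
    {g : EuclideanSpace ℝ (Fin N) → ℝ} (hu : MemH2 u G g) :
    Integrable (fun x => radialDensity a c x (G x)) ∧
      (∫ x, radialDensity a c x (G x)) ^ 2 ≤ K * ((∫ x, g x ^ 2) * ∫ x, ‖G x‖ ^ 2) := by
  obtain ⟨φ, hφ, -, hG, hg⟩ := hu.exists_approx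
  have hA : Tendsto (fun n => ∫ x, Laplacian.laplacian (φ n) x ^ 2) atTop (𝓝 (∫ x, g x ^ 2)) := by
    simpa using tendsto_integral_norm_sq_of_tendsto_eLpNorm (fun n => (hφ n).memLp_laplacian)
      hu.memLp_laplacian hg
  have hB : Tendsto (fun n => ∫ x, ‖gradient (φ n) x‖ ^ 2) atTop (𝓝 (∫ x, ‖G x‖ ^ 2)) :=
    tendsto_integral_norm_sq_of_tendsto_eLpNorm (fun n => (hφ n).memLp_gradient) hu.memLp_grad hG
  have hGm := hu.memLp_grad.aestronglyMeasurable
  -- A subsequence of gradients converging almost everywhere is what Fatou's lemma needs.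
  obtain ⟨s, hs, hae⟩ := (tendstoInMeasure_of_tendsto_eLpNorm two_ne_zero
    (fun n => (hφ n).memLp_gradient.aestronglyMeasurable) hGm hG).exists_seq_tendsto_ae
  set S := K * ((∫ x, g x ^ 2) * ∫ x, ‖G x‖ ^ 2) with hSdef
  have hS : Tendsto (fun n => K * ((∫ x, Laplacian.laplacian (φ n) x ^ 2) *
      ∫ x, ‖gradient (φ n) x‖ ^ 2)) atTop (𝓝 S) := (hA.mul hB).const_mul K
  have hS0 : 0 ≤ S := mul_nonneg hK (mul_nonneg (integral_nonneg fun x => sq_nonneg _)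
    (integral_nonneg fun x => sq_nonneg _))
  have hmeas : AEStronglyMeasurable (fun x => radialDensity a c x (G x)) volume := by
    unfold radialDensity
    have h1 : AEStronglyMeasurable (fun x : EuclideanSpace ℝ (Fin N) => ‖x‖⁻¹) volume :=
      measurable_norm.inv.aestronglyMeasurable
    have h2 : AEStronglyMeasurable (fun x : EuclideanSpace ℝ (Fin N) => ‖x‖⁻¹ • x) volume :=
      h1.smul aestronglyMeasurable_id
    exact ((((hGm.norm.pow 2).const_mul a)).add (((hGm.inner h2).pow 2).const_mul c)).mul h1
  -- The weighted side is only lower semicontinuous, while the right side converges. Working with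
  -- extended integrals also yields integrability of the limit density.
  have hfatou : ∫⁻ x, ENNReal.ofReal (radialDensity a c x (G x)) ≤ ENNReal.ofReal √S := by
    calc ∫⁻ x, ENNReal.ofReal (radialDensity a c x (G x))
        = ∫⁻ x, liminf (fun n => ENNReal.ofReal
            (radialDensity a c x (gradient (φ (s n)) x))) atTop := by
          refine lintegral_congr_ae ?_
          filter_upwards [hae] with x hx
          refine (Tendsto.liminf_eq ?_).symm
          refine (ENNReal.continuous_ofReal.tendsto _).comp ?_
          have hcont : Continuous fun V => radialDensity a c x V := by
            unfold radialDensity; fun_prop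
          exact (hcont.tendsto _).comp hx
      _ ≤ liminf (fun n => ∫⁻ x, ENNReal.ofReal
            (radialDensity a c x (gradient (φ (s n)) x))) atTop :=
          lintegral_liminf_le' fun n =>
            (htest _ (hφ (s n))).1.aestronglyMeasurable.aemeasurable.ennreal_ofReal
      _ ≤ liminf (fun n => ENNReal.ofReal √(K * ((∫ x, Laplacian.laplacian (φ (s n)) x ^ 2) *
            ∫ x, ‖gradient (φ (s n)) x‖ ^ 2))) atTop := by
          refine liminf_le_liminf (Eventually.of_forall fun n => ?_)
          rw [← ofReal_integral_eq_lintegral_ofReal (htest _ (hφ (s n))).1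
            (Eventually.of_forall fun x => radialDensity_nonneg ha hc _ _)]
          exact ENNReal.ofReal_le_ofReal (Real.le_sqrt_of_sq_le (htest _ (hφ (s n))).2)
      _ = ENNReal.ofReal √S := by
          refine Tendsto.liminf_eq ?_
          exact (ENNReal.continuous_ofReal.tendsto _).comp
            ((Real.continuous_sqrt.tendsto _).comp (hS.comp hs.tendsto_atTop))
  have hint : Integrable (fun x => radialDensity a c x (G x)) := by
    refine ⟨hmeas, ?_⟩
    rw [hasFiniteIntegral_iff_ofReal
      (Eventually.of_forall fun x => radialDensity_nonneg ha hc _ _)]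
    exact hfatou.trans_lt ENNReal.ofReal_lt_top
  refine ⟨hint, ?_⟩
  have h0 : 0 ≤ ∫ x, radialDensity a c x (G x) :=
    integral_nonneg fun x => radialDensity_nonneg ha hc _ _
  rw [← ofReal_integral_eq_lintegral_ofReal hint
    (Eventually.of_forall fun x => radialDensity_nonneg ha hc _ _),
    ENNReal.ofReal_le_ofReal_iff (Real.sqrt_nonneg _)] at hfatou
  calc _ ≤ √S ^ 2 := by gcongr
    _ = S := Real.sq_sqrt hS0

lemma radialDensity_one_zero {E : Type*} [NormedAddCommGroup E] [InnerProductSpace ℝ E]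
    (x V : E) : radialDensity 1 0 x V = ‖V‖ ^ 2 / ‖x‖ := by
  simp [radialDensity, div_eq_mul_inv]

end Fatou

/-! ### Plane rotations and their generators -/

section Rotation

variable {E : Type*} [NormedAddCommGroup E] [InnerProductSpace ℝ E]

/-- The vector field generating the rotations in the plane spanned by `a` and `b`. -/
noncomputable def rotationField (a b : E) : E →L[ℝ] E :=
  (innerSL ℝ a).smulRight b - (innerSL ℝ b).smulRight a

lemma rotationField_apply (a b x : E) : rotationField a b x = ⟪a, x⟫ • b - ⟪b, x⟫ • a := rfl

/-- The rotation by the angle `θ` in the plane spanned by the orthonormal vectors `a` and `b`. -/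
noncomputable def planeRotation (a b : E) (θ : ℝ) : E →L[ℝ] E :=
  ContinuousLinearMap.id ℝ E + (Real.cos θ - 1) • ((innerSL ℝ a).smulRight a +
    (innerSL ℝ b).smulRight b) + Real.sin θ • rotationField a b

lemma planeRotation_apply (a b : E) (θ : ℝ) (x : E) : planeRotation a b θ x =
    x + (Real.cos θ - 1) • (⟪a, x⟫ • a + ⟪b, x⟫ • b) + Real.sin θ • (⟪a, x⟫ • b - ⟪b, x⟫ • a) :=
  rfl

lemma planeRotation_zero (a b x : E) : planeRotation a b 0 x = x := by
  simp [planeRotation_apply]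

lemma norm_planeRotation {a b : E} (ha : ‖a‖ = 1) (hb : ‖b‖ = 1) (hab : ⟪a, b⟫ = 0)
    (θ : ℝ) (x : E) : ‖planeRotation a b θ x‖ = ‖x‖ := by
  have haa : ⟪a, a⟫ = 1 := by rw [real_inner_self_eq_norm_sq, ha]; norm_num
  have hbb : ⟪b, b⟫ = 1 := by rw [real_inner_self_eq_norm_sq, hb]; norm_num
  have hba : ⟪b, a⟫ = 0 := by rw [real_inner_comm]; exact hab
  have h : ⟪planeRotation a b θ x, planeRotation a b θ x⟫ = ⟪x, x⟫ := by
    rw [planeRotation_apply]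
    simp only [inner_sub_left, inner_sub_right, inner_add_left, inner_add_right,
      real_inner_smul_left, real_inner_smul_right, haa, hbb, hab, hba, real_inner_comm a x,
      real_inner_comm b x]
    have := Real.sin_sq_add_cos_sq θ
    linear_combination (⟪a, x⟫ ^ 2 + ⟪b, x⟫ ^ 2) * this
  rw [real_inner_self_eq_norm_sq, real_inner_self_eq_norm_sq] at h
  exact (sq_eq_sq₀ (norm_nonneg _) (norm_nonneg _)).1 h

lemma hasDerivAt_planeRotation {a b : E} (ha : ‖a‖ = 1) (hb : ‖b‖ = 1) (hab : ⟪a, b⟫ = 0)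
    (θ : ℝ) (x : E) :
    HasDerivAt (fun t => planeRotation a b t x)
      (rotationField a b (planeRotation a b θ x)) θ := by
  have haa : ⟪a, a⟫ = 1 := by rw [real_inner_self_eq_norm_sq, ha]; norm_num
  have hbb : ⟪b, b⟫ = 1 := by rw [real_inner_self_eq_norm_sq, hb]; norm_num
  have hba : ⟪b, a⟫ = 0 := by rw [real_inner_comm]; exact hab
  have h := ((((Real.hasDerivAt_cos θ).sub_const 1).smul_const (⟪a, x⟫ • a + ⟪b, x⟫ • b)).const_add
    x).add ((Real.hasDerivAt_sin θ).smul_const (⟪a, x⟫ • b - ⟪b, x⟫ • a))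
  refine h.congr_deriv ?_
  have e1 : ⟪a, planeRotation a b θ x⟫ = Real.cos θ * ⟪a, x⟫ - Real.sin θ * ⟪b, x⟫ := by
    rw [planeRotation_apply]
    simp only [inner_sub_right, inner_add_right, real_inner_smul_right, haa, hab]
    ring
  have e2 : ⟪b, planeRotation a b θ x⟫ = Real.cos θ * ⟪b, x⟫ + Real.sin θ * ⟪a, x⟫ := by
    rw [planeRotation_apply]
    simp only [inner_sub_right, inner_add_right, real_inner_smul_right, hbb, hba]
    ring
  rw [rotationField_apply, e1, e2]
  module

variable [FiniteDimensional ℝ E] [MeasurableSpace E] [BorelSpace E]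

lemma integral_comp_planeRotation {a b : E} (ha : ‖a‖ = 1) (hb : ‖b‖ = 1) (hab : ⟪a, b⟫ = 0)
    (θ : ℝ) (F : E → ℝ) :
    ∫ x, F (planeRotation a b θ x) = ∫ x, F x := by
  let L : E →ₗᵢ[ℝ] E :=
    ⟨(planeRotation a b θ : E →ₗ[ℝ] E), fun x => norm_planeRotation ha hb hab θ x⟩
  let e := L.toLinearIsometryEquiv rfl
  exact (e.measurePreserving (E := E) (F := E)).integral_comp
    e.toHomeomorph.measurableEmbedding F

/-- Radial functions are annihilated by the generators of rotations, in the sense of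
distributions. -/
lemma integral_radial_mul_fderiv_rotationField {a b : E} (ha : ‖a‖ = 1) (hb : ‖b‖ = 1) (hab : ⟪a, b⟫ = 0)
    {f : ℝ → ℝ}
    (hf : LocallyIntegrable fun x : E => f ‖x‖) {ψ : E → ℝ} (hψ : ContDiff ℝ 1 ψ)
    (hc : HasCompactSupport ψ) :
    ∫ x, f ‖x‖ * fderiv ℝ ψ x (rotationField a b x) = 0 := by
  have hψ'c : Continuous fun x => fderiv ℝ ψ x (rotationField a b x) := by
    have := hψ.continuous_fderiv (by simp)
    fun_prop
  have hψ's : HasCompactSupport fun x => fderiv ℝ ψ x (rotationField a b x) :=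
    (hc.fderiv (𝕜 := ℝ)).mono fun x hx h => hx (by simp [h])
  obtain ⟨M, hM⟩ := hψ'c.bounded_above_of_compact_support hψ's
  obtain ⟨R, hR⟩ := hψ's.isCompact.isBounded.subset_closedBall 0
  have hfm := hf.aestronglyMeasurable
  have hcont : ∀ θ, Continuous fun x => planeRotation a b θ x := fun θ => by fun_prop
  have hint : Integrable fun x => f ‖x‖ * ψ (planeRotation a b 0 x) := by
    simp only [planeRotation_zero]
    exact hf.integrable_smul_right_of_hasCompactSupport hψ.continuous hc
  have hbint : Integrable ((Metric.closedBall (0 : E) R).indicator fun x => |f ‖x‖| * M) := by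
    rw [integrable_indicator_iff measurableSet_closedBall]
    exact ((hf.integrableOn_isCompact (isCompact_closedBall 0 R)).norm).mul_const M
  -- Differentiate `∫ f(|x|) ψ(R_θ x)` at `θ = 0`; it is constant because rotations preserve both
  -- `|x|` and volume. They also preserve the ball of radius `R`, so one majorant serves all `θ`.
  have key := (hasDerivAt_integral_of_dominated_loc_of_deriv_le (μ := volume) (x₀ := (0 : ℝ))
    (F := fun θ x => f ‖x‖ * ψ (planeRotation a b θ x))
    (F' := fun θ x => f ‖x‖ * fderiv ℝ ψ (planeRotation a b θ x)
      (rotationField a b (planeRotation a b θ x)))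
    (bound := (Metric.closedBall (0 : E) R).indicator fun x => |f ‖x‖| * M) univ_mem
    (Eventually.of_forall fun θ =>
      hfm.mul (hψ.continuous.comp (hcont θ)).aestronglyMeasurable) hint
    (hfm.mul (hψ'c.comp (hcont 0)).aestronglyMeasurable)
    (Eventually.of_forall fun x θ _ => ?_) hbint (Eventually.of_forall fun x θ _ => ?_)).2
  · have hconst : ∀ θ, ∫ x, f ‖x‖ * ψ (planeRotation a b θ x) = ∫ x, f ‖x‖ * ψ x := by
      intro θ
      rw [← integral_comp_planeRotation ha hb hab θ fun x => f ‖x‖ * ψ x]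
      simp only [norm_planeRotation ha hb hab]
    simp only [hconst, planeRotation_zero] at key
    exact key.unique (hasDerivAt_const _ _)
  · by_cases hx : x ∈ Metric.closedBall (0 : E) R
    · rw [Set.indicator_of_mem hx, norm_mul]
      exact mul_le_mul_of_nonneg_left (hM _) (norm_nonneg _)
    · rw [Set.indicator_of_notMem hx]
      have : fderiv ℝ ψ (planeRotation a b θ x) (rotationField a b (planeRotation a b θ x)) = 0 := by
        refine image_eq_zero_of_notMem_tsupport
          (f := fun x => fderiv ℝ ψ x (rotationField a b x)) fun h => hx ?_
        have := hR h
        rwa [mem_closedBall_zero_iff, norm_planeRotation ha hb hab,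
          ← mem_closedBall_zero_iff] at this
      rw [this]; simp
  · have := ((hψ.differentiable (by simp) (planeRotation a b θ x)).hasFDerivAt).comp_hasDerivAt θ
      (hasDerivAt_planeRotation ha hb hab θ x)
    exact this.const_mul _

/-- The rotation field is divergence free: integrating its two terms by parts leaves `⟪a, b⟫ ∫ F`
with opposite signs. -/
lemma integral_fderiv_rotationField_eq_zero (a b : E) {F : E → ℝ} (hF : ContDiff ℝ 1 F)
    (hc : HasCompactSupport F) : ∫ x, fderiv ℝ F x (rotationField a b x) = 0 := by
  have hF' := hF.continuous_fderiv (by simp)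
  have hF'c := hc.fderiv (𝕜 := ℝ)
  have hint : ∀ c d : E, Integrable fun x => ⟪c, x⟫ * fderiv ℝ F x d := fun c d =>
    Continuous.integrable_of_hasCompactSupport (by fun_prop)
      (hF'c.mono fun x hx h => hx (by simp [h]))
  have key : ∀ c d : E, ∫ x, ⟪c, x⟫ * fderiv ℝ F x d = -∫ x, ⟪c, d⟫ * F x := by
    intro c d
    have hd : ∀ x, fderiv ℝ (fun y => ⟪c, y⟫) x d = ⟪c, d⟫ := fun x => by
      rw [fderiv_inner_apply ℝ (differentiableAt_const c) differentiableAt_fun_id]; simp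
    rw [integral_mul_fderiv_eq_neg_fderiv_mul_of_integrable (f := fun x => ⟪c, x⟫) ?_ (hint c d) ?_
      (fun x _ => (differentiableAt_const c).inner ℝ differentiableAt_fun_id)
      (fun x _ => hF.differentiable (by simp) x)]
    · simp only [hd]
    · simp only [hd]
      exact (hF.continuous.integrable_of_hasCompactSupport hc).const_mul _
    · exact Continuous.integrable_of_hasCompactSupport (by have := hF.continuous; fun_prop)
        hc.mul_left
  have e : ∀ x, fderiv ℝ F x (rotationField a b x)
      = ⟪a, x⟫ * fderiv ℝ F x b - ⟪b, x⟫ * fderiv ℝ F x a := fun x => by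
    simp [rotationField_apply]
  simp_rw [e]
  rw [integral_sub (hint a b) (hint b a), key, key, real_inner_comm]
  ring

end Rotation

/-! ### Weak gradients of radial functions -/

section WeakGradient

variable {N : ℕ}

/-- For the approximating test functions this is integration by parts along a divergence-free field.
The left side passes to the limit by `L²` convergence of gradients, the right side by local `L¹`
convergence. -/
lemma MemH2.integral_inner_rotationField {u : EuclideanSpace ℝ (Fin N) → ℝ}
    {G : EuclideanSpace ℝ (Fin N) → EuclideanSpace ℝ (Fin N)}
    {g : EuclideanSpace ℝ (Fin N) → ℝ} (hu : MemH2 u G g) (a b : EuclideanSpace ℝ (Fin N))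
    {ψ : EuclideanSpace ℝ (Fin N) → ℝ} (hψ : IsTestFunction ψ) :
    ∫ x, ⟪G x, ψ x • rotationField a b x⟫ =
      -∫ x, u x * fderiv ℝ ψ x (rotationField a b x) := by
  obtain ⟨φ, hφ, hL1, hG, -⟩ := hu.exists_approx
  have hψ1 : ContDiff ℝ 1 ψ := hψ.1.of_le (by simp)
  have hψ'c : Continuous fun x => fderiv ℝ ψ x (rotationField a b x) := by
    have := hψ1.continuous_fderiv (by simp)
    fun_prop
  have hψ's : HasCompactSupport fun x => fderiv ℝ ψ x (rotationField a b x) :=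
    (hψ.2.fderiv (𝕜 := ℝ)).mono fun x hx h => hx (by simp [h])
  have hYc : Continuous fun x => ψ x • rotationField a b x := by
    have := hψ.1.continuous; fun_prop
  have hYs : HasCompactSupport fun x => ψ x • rotationField a b x := hψ.2.smul_right
  have hY : MemLp (fun x => ψ x • rotationField a b x) 2 volume :=
    hYc.memLp_of_hasCompactSupport hYs
  have hn : ∀ n, ∫ x, ⟪gradient (φ n) x, ψ x • rotationField a b x⟫ =
      -∫ x, φ n x * fderiv ℝ ψ x (rotationField a b x) := by
    intro n
    have hφ1 : ContDiff ℝ 1 (φ n) := (hφ n).1.of_le (by simp)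
    have h0 := integral_fderiv_rotationField_eq_zero a b (hφ1.mul hψ1) hψ.2.mul_left
    have e : ∀ x, fderiv ℝ (fun y => φ n y * ψ y) x (rotationField a b x) =
        ⟪gradient (φ n) x, ψ x • rotationField a b x⟫
        + φ n x * fderiv ℝ ψ x (rotationField a b x) := by
      intro x
      rw [fderiv_fun_mul (hφ1.differentiable (by simp) x) (hψ1.differentiable (by simp) x),
        real_inner_smul_right, inner_gradient]
      simp [add_comm]
    have i1 : Integrable fun x => ⟪gradient (φ n) x, ψ x • rotationField a b x⟫ := by
      refine Continuous.integrable_of_hasCompactSupport ?_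
        (hYs.mono fun x hx h => hx (by simp only [h, inner_zero_right]))
      exact (hφ n).1.gradient_infty.continuous.inner hYc
    have i2 : Integrable fun x => φ n x * fderiv ℝ ψ x (rotationField a b x) :=
      ((hφ n).1.continuous.mul hψ'c).integrable_of_hasCompactSupport hψ's.mul_left
    rw [integral_congr_ae (Eventually.of_forall e), integral_add i1 i2] at h0
    linarith
  have l1 : Tendsto (fun n => ∫ x, ⟪gradient (φ n) x, ψ x • rotationField a b x⟫) atTop
      (𝓝 (∫ x, ⟪G x, ψ x • rotationField a b x⟫)) := by
    have h1 := (Lp.tendsto_Lp_iff_tendsto_eLpNorm'' _ (fun n => (hφ n).memLp_gradient) G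
      hu.memLp_grad).2 hG
    have h2 := Tendsto.inner (𝕜 := ℝ) h1 (tendsto_const_nhds (x := hY.toLp _))
    have e : ∀ {V : EuclideanSpace ℝ (Fin N) → EuclideanSpace ℝ (Fin N)} (hV : MemLp V 2 volume),
        ⟪hV.toLp V, hY.toLp _⟫ = ∫ x, ⟪V x, ψ x • rotationField a b x⟫ := by
      intro V hV
      rw [L2.inner_def]
      refine integral_congr_ae ?_
      filter_upwards [hV.coeFn_toLp, hY.coeFn_toLp] with x h1 h2
      rw [h1, h2]
    simpa only [e] using h2
  have l2 : Tendsto (fun n => ∫ x, φ n x * fderiv ℝ ψ x (rotationField a b x)) atTop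
      (𝓝 (∫ x, u x * fderiv ℝ ψ x (rotationField a b x))) := by
    set ψ' := fun x => fderiv ℝ ψ x (rotationField a b x) with hψ'
    obtain ⟨M, hM⟩ := hψ'c.bounded_above_of_compact_support hψ's
    have hi : Integrable fun x => u x * ψ' x :=
      hu.locallyIntegrable.integrable_smul_right_of_hasCompactSupport hψ'c hψ's
    refine tendsto_integral_of_L1 _ hi.aestronglyMeasurable (Eventually.of_forall fun n =>
      ((hφ n).1.continuous.mul hψ'c).integrable_of_hasCompactSupport hψ's.mul_left) ?_
    have hle : ∀ n, ∫⁻ x, ‖φ n x * ψ' x - u x * ψ' x‖ₑ ≤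
        ENNReal.ofReal M * ∫⁻ x in tsupport ψ', ‖φ n x - u x‖ₑ := by
      intro n
      rw [← lintegral_const_mul' _ _ ENNReal.ofReal_ne_top,
        ← lintegral_indicator (isClosed_tsupport _).measurableSet]
      refine lintegral_mono fun x => ?_
      by_cases hx : x ∈ tsupport ψ'
      · rw [Set.indicator_of_mem hx, ← sub_mul, enorm_mul, mul_comm]
        gcongr
        rw [← ofReal_norm]
        exact ENNReal.ofReal_le_ofReal (hM x)
      · rw [image_eq_zero_of_notMem_tsupport hx]; simp
    refine tendsto_of_tendsto_of_tendsto_of_le_of_le tendsto_const_nhds ?_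
      (fun _ => zero_le) hle
    have := ENNReal.Tendsto.const_mul (a := ENNReal.ofReal M) (hL1 _ hψ's)
      (Or.inr ENNReal.ofReal_ne_top)
    simpa using this
  exact tendsto_nhds_unique l1 (by simpa only [hn] using l2.neg)

/-- The gradient of a radial function is radial. -/
lemma MemH2.inner_sq_eq_of_isRadialAE {u : EuclideanSpace ℝ (Fin N) → ℝ}
    {G : EuclideanSpace ℝ (Fin N) → EuclideanSpace ℝ (Fin N)}
    {g : EuclideanSpace ℝ (Fin N) → ℝ} (hu : MemH2 u G g) (hr : IsRadialAE u) :
    ∀ᵐ x, ⟪G x, x⟫ ^ 2 = ‖G x‖ ^ 2 * ‖x‖ ^ 2 := by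
  obtain ⟨f, hf⟩ := hr
  set e := EuclideanSpace.basisFun (Fin N) ℝ with he
  have hfl : LocallyIntegrable fun x : EuclideanSpace ℝ (Fin N) => f ‖x‖ :=
    hu.locallyIntegrable.congr hf
  -- The angular derivatives of `u` vanish as distributions, hence almost everywhere by the
  -- fundamental lemma of the calculus of variations.
  have hij : ∀ i j, ∀ᵐ x, ⟪G x, rotationField (e i) (e j) x⟫ = 0 := by
    intro i j
    by_cases hne : i = j
    · subst hne
      exact Eventually.of_forall fun x => by simp [rotationField_apply]
    have hGl : ∀ c, LocallyIntegrable fun x => ⟪G x, c⟫ := fun c =>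
      (hu.memLp_grad.inner_const c).locallyIntegrable (by norm_num)
    have hloc : LocallyIntegrable fun x => ⟪G x, rotationField (e i) (e j) x⟫ := by
      simp only [rotationField_apply, inner_sub_right, real_inner_smul_right]
      exact ((hGl _).continuous_mul (by fun_prop)).sub ((hGl _).continuous_mul (by fun_prop))
    refine ae_eq_zero_of_integral_contDiff_smul_eq_zero hloc fun ψ hψ hψc => ?_
    have h1 := hu.integral_inner_rotationField (e i) (e j) ⟨hψ, hψc⟩
    have h2 : ∫ x, u x * fderiv ℝ ψ x (rotationField (e i) (e j) x) = 0 := by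
      rw [← integral_radial_mul_fderiv_rotationField (e.norm_eq_one i) (e.norm_eq_one j)
        (e.orthonormal.2 hne) hfl (hψ.of_le (by simp)) hψc]
      refine integral_congr_ae ?_
      filter_upwards [hf] with x hx
      rw [hx]
    rw [h2, neg_zero] at h1
    simpa only [real_inner_smul_right, smul_eq_mul] using h1
  have hall : ∀ᵐ x, ∀ i j, ⟪G x, rotationField (e i) (e j) x⟫ = 0 :=
    ae_all_iff.2 fun i => ae_all_iff.2 fun j => hij i j
  filter_upwards [hall] with x hx
  -- All two-by-two minors of the pair `x, G x` vanish, so the two are parallel; equality in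
  -- Cauchy–Schwarz then holds term by term in the double sum.
  have h1 : ∀ i j, ⟪e i, x⟫ * ⟪e j, G x⟫ = ⟪e j, x⟫ * ⟪e i, G x⟫ := by
    intro i j
    have := hx i j
    rw [rotationField_apply, inner_sub_right, real_inner_smul_right, real_inner_smul_right,
      real_inner_comm (e j), real_inner_comm (e i)] at this
    linarith
  rw [← real_inner_self_eq_norm_sq, ← real_inner_self_eq_norm_sq, ← e.sum_inner_mul_inner (G x) x,
    ← e.sum_inner_mul_inner (G x) (G x), ← e.sum_inner_mul_inner x x, sq, Finset.sum_mul_sum,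
    Finset.sum_mul_sum]
  refine Finset.sum_congr rfl fun i _ => Finset.sum_congr rfl fun j _ => ?_
  have := h1 i j
  rw [real_inner_comm (e i) (G x), real_inner_comm (e j) (G x), real_inner_comm (e j) x]
  linear_combination ⟪e i, G x⟫ * ⟪e j, x⟫ * this

end WeakGradient

/-! ### Exponential moments in polar coordinates -/

section Moments

lemma integrableOn_pow_mul_exp_neg_two_mul (q : ℕ) :
    IntegrableOn (fun y : ℝ => y ^ q * Real.exp (-(2 * y))) (Set.Ioi 0) := by
  have h := integrableOn_rpow_mul_exp_neg_mul_rpow (p := 1) (s := q) (b := 2)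
    (by have : (0 : ℝ) ≤ q := Nat.cast_nonneg q
        linarith) one_pos two_pos
  refine h.congr_fun (fun y _ => ?_) measurableSet_Ioi
  simp only [Real.rpow_natCast, Real.rpow_one, neg_mul]

lemma integral_pow_mul_exp_neg_two_mul (q : ℕ) :
    ∫ y in Set.Ioi (0 : ℝ), y ^ q * Real.exp (-(2 * y)) = q.factorial / 2 ^ (q + 1) := by
  have h := Real.integral_rpow_mul_exp_neg_mul_Ioi (a := q + 1) (r := 2) (by positivity) two_pos
  simp only [add_sub_cancel_right, Real.rpow_natCast] at h
  rw [h, Real.Gamma_nat_eq_factorial]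
  have : ((1 : ℝ) / 2) ^ ((q : ℝ) + 1) = (1 / 2) ^ (q + 1) := by
    rw [← Real.rpow_natCast]; push_cast; rfl
  rw [this, div_pow, one_pow]
  ring

variable {N : ℕ}

/-- The surface measure of the unit sphere of `ℝ^N`. -/
noncomputable def sphereArea (N : ℕ) : ℝ :=
  N * (volume : Measure (EuclideanSpace ℝ (Fin N))).real (Metric.ball 0 1)

lemma sphereArea_pos (hN : 2 ≤ N) : 0 < sphereArea N := by
  have : 0 < (N : ℝ) := by exact_mod_cast (by omega : 0 < N)
  refine mul_pos this ?_
  exact ENNReal.toReal_pos (Metric.measure_ball_pos _ _ one_pos).ne' measure_ball_lt_top.ne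

/-- Polar coordinates reduce this to a Gamma integral. The hypothesis concerns the product with the
Jacobian, so `f` may be singular at the origin while `q` stays a natural number. -/
lemma integral_radial_exp (hN : 2 ≤ N) (q : ℕ) {f : ℝ → ℝ}
    (hf : ∀ r, 0 < r → r ^ (N - 1) * f r = r ^ q * Real.exp (-(2 * r))) :
    Integrable (fun x : EuclideanSpace ℝ (Fin N) => f ‖x‖) ∧
      ∫ x : EuclideanSpace ℝ (Fin N), f ‖x‖ = sphereArea N * (q.factorial / 2 ^ (q + 1)) := by
  have : Nontrivial (EuclideanSpace ℝ (Fin N)) :=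
    Module.nontrivial_of_finrank_pos (R := ℝ) (by simp; omega)
  constructor
  · rw [integrable_fun_norm_addHaar volume, finrank_euclideanSpace_fin]
    exact (integrableOn_pow_mul_exp_neg_two_mul q).congr_fun (fun y hy => (hf y hy).symm)
      measurableSet_Ioi
  · rw [integral_fun_norm_addHaar, finrank_euclideanSpace_fin, ← integral_pow_mul_exp_neg_two_mul,
      sphereArea, nsmul_eq_mul, smul_eq_mul, mul_assoc]
    congr 2
    exact setIntegral_congr_fun measurableSet_Ioi hf

/-- Exchanging two coordinates is an isometry, so all coordinates contribute equally, and their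
squares sum to `|x|²`. -/
lemma integral_coord_sq_mul_radial {F : ℝ → ℝ} (hF : Measurable F)
    (hi : Integrable fun x : EuclideanSpace ℝ (Fin N) => ‖x‖ ^ 2 * F ‖x‖) (i : Fin N) :
    Integrable (fun x : EuclideanSpace ℝ (Fin N) => x i ^ 2 * F ‖x‖) ∧
      N * ∫ x : EuclideanSpace ℝ (Fin N), x i ^ 2 * F ‖x‖ =
        ∫ x : EuclideanSpace ℝ (Fin N), ‖x‖ ^ 2 * F ‖x‖ := by
  have hint : ∀ j, Integrable (fun x : EuclideanSpace ℝ (Fin N) => x j ^ 2 * F ‖x‖) := by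
    intro j
    refine hi.mono ?_ (Eventually.of_forall fun x => ?_)
    · have h1 : Measurable fun x : EuclideanSpace ℝ (Fin N) => F ‖x‖ := hF.comp measurable_norm
      have h2 : Measurable fun x : EuclideanSpace ℝ (Fin N) => x j := by fun_prop
      exact ((h2.pow_const 2).mul h1).aestronglyMeasurable
    · rw [norm_mul, norm_mul, norm_pow, norm_pow, norm_norm]
      gcongr
      exact PiLp.norm_apply_le x j
  have hswap : ∀ j, ∫ x : EuclideanSpace ℝ (Fin N), x j ^ 2 * F ‖x‖ =
      ∫ x : EuclideanSpace ℝ (Fin N), x i ^ 2 * F ‖x‖ := by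
    intro j
    let e := LinearIsometryEquiv.piLpCongrLeft 2 ℝ ℝ (Equiv.swap i j)
    have he : ∀ x : EuclideanSpace ℝ (Fin N), e x i = x j := fun x => by
      simp [e, LinearIsometryEquiv.piLpCongrLeft_apply, Equiv.piCongrLeft']
    have := (LinearIsometryEquiv.measurePreserving (E := EuclideanSpace ℝ (Fin N))
      (F := EuclideanSpace ℝ (Fin N)) e).integral_comp
      e.toHomeomorph.measurableEmbedding (fun x => x i ^ 2 * F ‖x‖)
    rw [← this]
    simp only [he, LinearIsometryEquiv.norm_map]
  refine ⟨hint i, ?_⟩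
  have h1 : ∀ x : EuclideanSpace ℝ (Fin N), ‖x‖ ^ 2 * F ‖x‖ = ∑ j, x j ^ 2 * F ‖x‖ := by
    intro x
    rw [EuclideanSpace.real_norm_sq_eq, Finset.sum_mul]
  simp_rw [h1]
  rw [integral_finsetSum _ fun j _ => hint j]
  simp [hswap]

end Moments

/-! ### A linear function times a radial profile -/

section Profile

variable {E : Type*} [NormedAddCommGroup E] [InnerProductSpace ℝ E] [FiniteDimensional ℝ E]

/-- Gradient and Laplacian of `x ↦ ⟨e, x⟩ k(|x|²)`. -/
lemma gradient_laplacian_inner_mul_radial (e : E) {k k₁ k₂ : ℝ → ℝ}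
    (hk : ∀ s, 0 ≤ s → HasDerivAt k (k₁ s) s) (hk₁ : ∀ s, 0 ≤ s → HasDerivAt k₁ (k₂ s) s)
    {u : E → ℝ} (hu : ∀ x, u x = ⟪e, x⟫ * k (‖x‖ ^ 2)) (hus : ContDiff ℝ ∞ u) (x : E) :
    gradient u x = k (‖x‖ ^ 2) • e + (2 * ⟪e, x⟫ * k₁ (‖x‖ ^ 2)) • x ∧
      Laplacian.laplacian u x = ⟪e, x⟫ * ((2 * Module.finrank ℝ E + 4) * k₁ (‖x‖ ^ 2)
        + 4 * ‖x‖ ^ 2 * k₂ (‖x‖ ^ 2)) := by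
  -- A profile in `|x|²` rather than `|x|` makes the chain rule valid at the origin too.
  have hsq : ∀ y : E, HasFDerivAt (fun z : E => ‖z‖ ^ 2) (2 • innerSL ℝ y) y := fun y =>
    (hasStrictFDerivAt_norm_sq y).hasFDerivAt
  have hin : ∀ y : E, HasFDerivAt (fun z : E => ⟪e, z⟫) (innerSL ℝ e) y := fun y =>
    (innerSL ℝ e).hasFDerivAt
  have hK : ∀ y : E, HasFDerivAt (fun z : E => k (‖z‖ ^ 2)) (k₁ (‖y‖ ^ 2) • 2 • innerSL ℝ y) y :=
    fun y => (hk _ (sq_nonneg _)).comp_hasFDerivAt y (hsq y)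
  have hK₁ : ∀ y : E, HasFDerivAt (fun z : E => k₁ (‖z‖ ^ 2)) (k₂ (‖y‖ ^ 2) • 2 • innerSL ℝ y) y :=
    fun y => (hk₁ _ (sq_nonneg _)).comp_hasFDerivAt y (hsq y)
  have hgrad : gradient u = fun y => k (‖y‖ ^ 2) • e + (2 * ⟪e, y⟫ * k₁ (‖y‖ ^ 2)) • y := by
    ext1 y
    refine ext_inner_right ℝ fun v => ?_
    have hu' : u = fun x => ⟪e, x⟫ * k (‖x‖ ^ 2) := funext hu
    rw [inner_gradient, hu', ((hin y).fun_mul (hK y)).fderiv, inner_add_left, real_inner_smul_left,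
      real_inner_smul_left]
    simp
    ring
  refine ⟨by rw [hgrad], ?_⟩
  set b := stdOrthonormalBasis ℝ E
  have hD : HasFDerivAt (gradient u) ((k₁ (‖x‖ ^ 2) • 2 • innerSL ℝ x).smulRight e +
      ((2 * ⟪e, x⟫ * k₁ (‖x‖ ^ 2)) • ContinuousLinearMap.id ℝ E +
        ((2 * ⟪e, x⟫) • k₂ (‖x‖ ^ 2) • 2 • innerSL ℝ x +
          k₁ (‖x‖ ^ 2) • (2 : ℝ) • innerSL ℝ e).smulRight x)) x := by
    rw [hgrad]
    exact ((hK x).smul_const e).add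
      ((((hin x).const_mul 2).fun_mul (hK₁ x)).smul (hasFDerivAt_id x))
  rw [laplacian_eq_sum_inner b hus, hD.fderiv]
  have key : ∀ i, ⟪((k₁ (‖x‖ ^ 2) • 2 • innerSL ℝ x).smulRight e +
      ((2 * ⟪e, x⟫ * k₁ (‖x‖ ^ 2)) • ContinuousLinearMap.id ℝ E +
        ((2 * ⟪e, x⟫) • k₂ (‖x‖ ^ 2) • 2 • innerSL ℝ x +
          k₁ (‖x‖ ^ 2) • (2 : ℝ) • innerSL ℝ e).smulRight x)) (b i), b i⟫ =
      2 * k₁ (‖x‖ ^ 2) * (⟪x, b i⟫ * ⟪b i, e⟫) + 2 * ⟪e, x⟫ * k₁ (‖x‖ ^ 2) * 1 +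
        4 * ⟪e, x⟫ * k₂ (‖x‖ ^ 2) * (⟪x, b i⟫ * ⟪b i, x⟫)
        + 2 * k₁ (‖x‖ ^ 2) * (⟪e, b i⟫ * ⟪b i, x⟫) := by
    intro i
    simp [inner_add_left, real_inner_smul_left, real_inner_comm (b i) e,
      real_inner_comm (b i) x, b.norm_eq_one]
    ring
  refine (Finset.sum_congr rfl fun i _ => key i).trans ?_
  simp only [Finset.sum_add_distrib, ← Finset.mul_sum, b.sum_inner_mul_inner,
    real_inner_self_eq_norm_sq, Finset.sum_const, Finset.card_univ, Fintype.card_fin, nsmul_eq_mul,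
    real_inner_comm e x]
  ring

end Profile

/-! ### The truncated exponential and its derivatives -/

section ExpProfile

/-- `e^{-t}`, smoothly cut off near `t = m`. -/
noncomputable def expCutoff (m : ℝ) (t : ℝ) : ℝ :=
  Real.exp (-t) * Real.smoothTransition (m - t)

noncomputable def expCutoffDeriv (m : ℝ) (t : ℝ) : ℝ :=
  -(Real.exp (-t) * (Real.smoothTransition (m - t) + deriv Real.smoothTransition (m - t)))

noncomputable def expCutoffDeriv₂ (m : ℝ) (t : ℝ) : ℝ :=
  Real.exp (-t) * (Real.smoothTransition (m - t) + 2 * deriv Real.smoothTransition (m - t)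
    + deriv (deriv Real.smoothTransition) (m - t))

lemma contDiff_expCutoff (m : ℝ) : ContDiff ℝ ∞ (expCutoff m) :=
  (Real.contDiff_exp.comp contDiff_neg).mul
    (Real.smoothTransition.contDiff.comp (contDiff_const.sub contDiff_id))

lemma hasDerivAt_expCutoff (m t : ℝ) : HasDerivAt (expCutoff m) (expCutoffDeriv m t) t := by
  have h1 : HasDerivAt (fun t : ℝ => Real.exp (-t)) (Real.exp (-t) * -1) t :=
    (Real.hasDerivAt_exp (-t)).comp t (hasDerivAt_neg t)
  have h2 : HasDerivAt (fun t : ℝ => Real.smoothTransition (m - t))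
      (deriv Real.smoothTransition (m - t) * -1) t :=
    ((Real.smoothTransition.contDiff (n := 1)).differentiable (by simp) _).hasDerivAt.comp t
      ((hasDerivAt_id t).const_sub m)
  exact (h1.mul h2).congr_deriv (by rw [expCutoffDeriv]; ring)

lemma hasDerivAt_expCutoffDeriv (m t : ℝ) :
    HasDerivAt (expCutoffDeriv m) (expCutoffDeriv₂ m t) t := by
  have h1 : HasDerivAt (fun t : ℝ => Real.exp (-t)) (Real.exp (-t) * -1) t :=
    (Real.hasDerivAt_exp (-t)).comp t (hasDerivAt_neg t)
  have h2 : HasDerivAt (fun t : ℝ => Real.smoothTransition (m - t))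
      (deriv Real.smoothTransition (m - t) * -1) t :=
    ((Real.smoothTransition.contDiff (n := 1)).differentiable (by simp) _).hasDerivAt.comp t
      ((hasDerivAt_id t).const_sub m)
  have hd : ContDiff ℝ 1 (deriv Real.smoothTransition) :=
    (Real.smoothTransition.contDiff (n := 2)).deriv' (n := 1)
  have h3 : HasDerivAt (fun t : ℝ => deriv Real.smoothTransition (m - t))
      (deriv (deriv Real.smoothTransition) (m - t) * -1) t :=
    (hd.differentiable (by simp) _).hasDerivAt.comp t ((hasDerivAt_id t).const_sub m)
  exact (h1.mul (h2.add h3)).neg.congr_deriv (by simp only [Pi.add_apply]; rw [expCutoffDeriv₂]; ring)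

lemma expCutoff_eq_zero {m t : ℝ} (h : m ≤ t) : expCutoff m t = 0 := by
  rw [expCutoff, Real.smoothTransition.zero_of_nonpos (by linarith), mul_zero]

/-- Uniform bounds on the cut off exponential. -/
lemma exists_expCutoff_bound : ∃ K, 1 ≤ K ∧ ∀ m t, |expCutoff m t| ≤ Real.exp (-t) ∧
    |expCutoffDeriv m t| ≤ K * Real.exp (-t) ∧ |expCutoffDeriv₂ m t| ≤ K * Real.exp (-t) := by
  have hd : ContDiff ℝ 1 (deriv Real.smoothTransition) :=
    (Real.smoothTransition.contDiff (n := 2)).deriv' (n := 1)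
  obtain ⟨L, hL0, hL⟩ := Real.smoothTransition.exists_deriv_bound
  obtain ⟨M, hM⟩ := (hd.continuous_deriv (by simp)).bounded_above_of_compact_support
    Real.smoothTransition.hasCompactSupport_deriv.deriv
  have hM0 : 0 ≤ M := (norm_nonneg _).trans (hM 0)
  have hS : ∀ t, |Real.smoothTransition t| ≤ 1 := fun t => by
    rw [abs_of_nonneg (Real.smoothTransition.nonneg _)]; exact Real.smoothTransition.le_one _
  refine ⟨1 + 2 * L + M, by linarith, fun m t => ⟨?_, ?_, ?_⟩⟩
  · rw [expCutoff, abs_mul, Real.abs_exp]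
    exact mul_le_of_le_one_right (Real.exp_pos _).le (hS _)
  · rw [expCutoffDeriv, abs_neg, abs_mul, Real.abs_exp, mul_comm]
    gcongr
    refine (abs_add_le _ _).trans ?_
    linarith [hS (m - t), hL (m - t)]
  · rw [expCutoffDeriv₂, abs_mul, Real.abs_exp, mul_comm]
    gcongr
    refine (abs_add_three _ _ _).trans ?_
    rw [abs_mul, abs_two]
    have := hM (m - t)
    rw [Real.norm_eq_abs] at this
    linarith [hS (m - t), hL (m - t)]

lemma Real.smoothTransition.deriv_deriv_of_one_lt {x : ℝ} (hx : 1 < x) :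
    deriv (deriv Real.smoothTransition) x = 0 := by
  have : deriv Real.smoothTransition =ᶠ[𝓝 x] fun _ => 0 := by
    filter_upwards [Ioi_mem_nhds hx] with y hy
    exact Real.smoothTransition.deriv_of_one_lt hy
  rw [this.deriv_eq, deriv_const]

/-- As `m - t m` tends to infinity, the cutoff is eventually one there, with vanishing derivatives.
The argument varies with `m` because the regularised radius does. -/
lemma tendsto_expCutoff {t : ℕ → ℝ} {t₀ : ℝ} (ht : Tendsto t atTop (𝓝 t₀)) :
    Tendsto (fun m : ℕ => expCutoff m (t m)) atTop (𝓝 (Real.exp (-t₀))) ∧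
    Tendsto (fun m : ℕ => expCutoffDeriv m (t m)) atTop (𝓝 (-Real.exp (-t₀))) ∧
    Tendsto (fun m : ℕ => expCutoffDeriv₂ m (t m)) atTop (𝓝 (Real.exp (-t₀))) := by
  have hexp : Tendsto (fun m => Real.exp (-t m)) atTop (𝓝 (Real.exp (-t₀))) :=
    (Real.continuous_exp.tendsto _).comp ht.neg
  have hev : ∀ᶠ m : ℕ in atTop, 1 < (m : ℝ) - t m := by
    have : Tendsto (fun m : ℕ => (m : ℝ) - t m) atTop atTop := by
      simp_rw [sub_eq_add_neg]
      exact tendsto_natCast_atTop_atTop.atTop_add ht.neg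
    exact this.eventually_gt_atTop 1
  refine ⟨hexp.congr' ?_, hexp.neg.congr' ?_, hexp.congr' ?_⟩
  · filter_upwards [hev] with m hm
    rw [expCutoff, Real.smoothTransition.one_of_one_le hm.le, mul_one]
  · filter_upwards [hev] with m hm
    rw [expCutoffDeriv, Real.smoothTransition.one_of_one_le hm.le,
      Real.smoothTransition.deriv_of_one_lt hm, add_zero, mul_one]
  · filter_upwards [hev] with m hm
    rw [expCutoffDeriv₂, Real.smoothTransition.one_of_one_le hm.le,
      Real.smoothTransition.deriv_of_one_lt hm, Real.smoothTransition.deriv_deriv_of_one_lt hm]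
    ring

end ExpProfile

/-! ### The trial function and the upper bound -/

section Trial

variable {N : ℕ}

/-- The prefactor is the integral of `e^{-2|x|}`; the coefficients of `a, b, d` are the ratios of
neighbouring Gamma values to it. -/
lemma integral_radial_quadratic_exp (hN : 2 ≤ N) (a b c d : ℝ) {f : ℝ → ℝ}
    (hf : ∀ r, 0 < r → f r = (a * r ^ 2 + b * r + c + d * r⁻¹) * Real.exp (-(2 * r))) :
    Integrable (fun x : EuclideanSpace ℝ (Fin N) => f ‖x‖) ∧
      ∫ x : EuclideanSpace ℝ (Fin N), f ‖x‖ = sphereArea N * ((N - 1).factorial / 2 ^ N) *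
        (a * (N * (N + 1) / 4) + b * (N / 2) + c + d * (2 / (N - 1))) := by
  obtain ⟨n, rfl⟩ : ∃ n, N = n + 2 := ⟨N - 2, by omega⟩
  have : Nontrivial (EuclideanSpace ℝ (Fin (n + 2))) :=
    Module.nontrivial_of_finrank_pos (R := ℝ) (by simp)
  obtain ⟨i3, e3⟩ := integral_radial_exp hN (n + 3) (f := fun r => r ^ 2 * Real.exp (-(2 * r)))
    (fun r _ => by rw [show n + 2 - 1 = n + 1 by omega]; ring)
  obtain ⟨i2, e2⟩ := integral_radial_exp hN (n + 2) (f := fun r => r * Real.exp (-(2 * r)))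
    (fun r _ => by rw [show n + 2 - 1 = n + 1 by omega]; ring)
  obtain ⟨i1, e1⟩ := integral_radial_exp hN (n + 1) (f := fun r => Real.exp (-(2 * r)))
    (fun r _ => by rw [show n + 2 - 1 = n + 1 by omega])
  obtain ⟨i0, e0⟩ := integral_radial_exp hN n (f := fun r => r⁻¹ * Real.exp (-(2 * r)))
    (fun r hr => by rw [show n + 2 - 1 = n + 1 by omega]; field_simp; ring)
  have hae : (fun x : EuclideanSpace ℝ (Fin (n + 2)) => f ‖x‖) =ᵐ[volume]
      fun x => a * (‖x‖ ^ 2 * Real.exp (-(2 * ‖x‖))) + b * (‖x‖ * Real.exp (-(2 * ‖x‖)))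
        + c * Real.exp (-(2 * ‖x‖)) + d * (‖x‖⁻¹ * Real.exp (-(2 * ‖x‖))) := by
    filter_upwards [show ∀ᵐ x : EuclideanSpace ℝ (Fin (n + 2)), x ≠ 0 by simp [ae_iff]] with x hx
    rw [hf _ (norm_pos_iff.2 hx)]
    ring
  have j3 := i3.const_mul a
  have j2 := i2.const_mul b
  have j1 := i1.const_mul c
  have j0 := i0.const_mul d
  refine ⟨(((j3.add j2).add j1).add j0).congr hae.symm, ?_⟩
  rw [integral_congr_ae hae, integral_add (by exact (j3.add j2).add j1) j0,
    integral_add (by exact j3.add j2) j1, integral_add j3 j2, integral_const_mul,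
    integral_const_mul, integral_const_mul, integral_const_mul, e3, e2, e1, e0]
  rw [show n + 2 - 1 = n + 1 by omega, Nat.factorial_succ (n + 2), Nat.factorial_succ (n + 1),
    Nat.factorial_succ n]
  push_cast
  have : (n : ℝ) + 2 - 1 ≠ 0 := by
    have := Nat.cast_nonneg (α := ℝ) n
    linarith
  field_simp
  ring

lemma integral_coord_sq_radial_quadratic_exp (hN : 2 ≤ N) (a b c d : ℝ) {F : ℝ → ℝ}
    (hF : Measurable F)
    (hf : ∀ r, 0 < r → r ^ 2 * F r = (a * r ^ 2 + b * r + c + d * r⁻¹) * Real.exp (-(2 * r)))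
    (i : Fin N) :
    Integrable (fun x : EuclideanSpace ℝ (Fin N) => x i ^ 2 * F ‖x‖) ∧
      ∫ x : EuclideanSpace ℝ (Fin N), x i ^ 2 * F ‖x‖ =
        sphereArea N * ((N - 1).factorial / 2 ^ N) *
        ((a * (N * (N + 1) / 4) + b * (N / 2) + c + d * (2 / (N - 1))) / N) := by
  obtain ⟨h1, h2⟩ := integral_radial_quadratic_exp hN a b c d (f := fun r => r ^ 2 * F r) hf
  obtain ⟨h3, h4⟩ := integral_coord_sq_mul_radial hF h1 i
  refine ⟨h3, ?_⟩
  rw [h2] at h4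
  have : (N : ℝ) ≠ 0 := by exact_mod_cast (by omega : N ≠ 0)
  field_simp
  field_simp at h4
  linarith

/-- Smooth, compactly supported approximations of `x_i e^{-|x|}`. -/
noncomputable def hydrogenTrial (i : Fin N) (m : ℕ) (x : EuclideanSpace ℝ (Fin N)) : ℝ :=
  x i * expCutoff m √(‖x‖ ^ 2 + (1 / ((m : ℝ) + 1)) ^ 2)

lemma isTestFunction_hydrogenTrial (i : Fin N) (m : ℕ) : IsTestFunction (hydrogenTrial i m) := by
  constructor
  -- The positive shift removes the singularity of the square root at the origin; `m + 1` covers `m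
  -- = 0`.
  · have h1 : ContDiff ℝ ∞ fun x : EuclideanSpace ℝ (Fin N) =>
        √(‖x‖ ^ 2 + (1 / ((m : ℝ) + 1)) ^ 2) :=
      ((contDiff_norm_sq ℝ).add contDiff_const).sqrt fun x => by positivity
    have h2 : ContDiff ℝ ∞ fun x : EuclideanSpace ℝ (Fin N) => x i := by fun_prop
    exact h2.mul ((contDiff_expCutoff m).comp h1)
  · refine HasCompactSupport.intro (isCompact_closedBall 0 (m : ℝ)) fun x hx => ?_
    rw [hydrogenTrial, expCutoff_eq_zero, mul_zero]
    rw [mem_closedBall_zero_iff, not_le] at hx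
    refine hx.le.trans (Real.le_sqrt_of_sq_le ?_)
    have := sq_nonneg (1 / ((m : ℝ) + 1))
    linarith

/-- The chain rule through `s ↦ √(s + δ²)`. Writing the result in terms of `ρ` prepares both the
bound `|x| ≤ ρ` and the limit `ρ → |x|`. -/
lemma gradient_laplacian_hydrogenTrial (i : Fin N) (m : ℕ) (x : EuclideanSpace ℝ (Fin N)) {ρ : ℝ}
    (hρ : ρ = √(‖x‖ ^ 2 + (1 / ((m : ℝ) + 1)) ^ 2)) :
    gradient (hydrogenTrial i m) x = expCutoff m ρ • EuclideanSpace.single i (1 : ℝ) +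
        (x i * (expCutoffDeriv m ρ / ρ)) • x ∧
      Laplacian.laplacian (hydrogenTrial i m) x = x i * ((N + 2) * (expCutoffDeriv m ρ / ρ) +
        ‖x‖ ^ 2 * (expCutoffDeriv₂ m ρ / ρ ^ 2 - expCutoffDeriv m ρ / ρ ^ 3)) := by
  set δ : ℝ := 1 / ((m : ℝ) + 1) with hδ
  have hδ0 : 0 < δ := by positivity
  have hsqrt : ∀ s : ℝ, 0 ≤ s → HasDerivAt (fun s => √(s + δ ^ 2)) (1 / (2 * √(s + δ ^ 2))) s :=
    fun s hs => ((hasDerivAt_id s).add_const (δ ^ 2)).sqrt (by simp only [id]; positivity)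
  have hpos : ∀ s : ℝ, 0 ≤ s → √(s + δ ^ 2) ≠ 0 := fun s hs => by positivity
  have hk : ∀ s : ℝ, 0 ≤ s → HasDerivAt (fun s => expCutoff m √(s + δ ^ 2))
      (expCutoffDeriv m √(s + δ ^ 2) / (2 * √(s + δ ^ 2))) s := fun s hs =>
    ((hasDerivAt_expCutoff m _).comp s (hsqrt s hs)).congr_deriv (by ring)
  have hk₁ : ∀ s : ℝ, 0 ≤ s →
      HasDerivAt (fun s => expCutoffDeriv m √(s + δ ^ 2) / (2 * √(s + δ ^ 2)))
      (expCutoffDeriv₂ m √(s + δ ^ 2) / (4 * √(s + δ ^ 2) ^ 2) -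
        expCutoffDeriv m √(s + δ ^ 2) / (4 * √(s + δ ^ 2) ^ 3)) s := fun s hs =>
    (((hasDerivAt_expCutoffDeriv m _).comp s (hsqrt s hs)).div ((hsqrt s hs).const_mul 2)
      (mul_ne_zero two_ne_zero (hpos s hs))).congr_deriv (by
        have := hpos s hs
        simp only [Function.comp_apply]
        field_simp
        ring)
  have hin : ∀ y : EuclideanSpace ℝ (Fin N), ⟪EuclideanSpace.single i (1 : ℝ), y⟫ = y i :=
    fun y => by simp [EuclideanSpace.inner_single_left]
  obtain ⟨h1, h2⟩ := gradient_laplacian_inner_mul_radial (EuclideanSpace.single i (1 : ℝ)) hk hk₁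
    (u := hydrogenTrial i m) (fun y => by rw [hin]; rfl) (isTestFunction_hydrogenTrial i m).1 x
  have hρ0 : ρ ≠ 0 := by rw [hρ]; exact hpos _ (sq_nonneg _)
  rw [hin, ← hρ] at h1 h2
  rw [h1, h2, finrank_euclideanSpace_fin]
  constructor
  · congr 2
    field_simp
  · congr 1
    field_simp
    ring

/-- Uniformity in `m` follows from `|x| ≤ ρ`: the quotients `|x|/ρ` are at most one and `e^{-ρ} ≤
e^{-|x|}`. This supplies the majorants for dominated convergence. -/
lemma exists_hydrogenTrial_bound (i : Fin N) : ∃ K, 0 ≤ K ∧ ∀ m x,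
    ‖gradient (hydrogenTrial i m) x‖ ≤ K * ((1 + ‖x‖) * Real.exp (-‖x‖)) ∧
    |Laplacian.laplacian (hydrogenTrial i m) x| ≤ K * ((1 + ‖x‖) * Real.exp (-‖x‖)) := by
  obtain ⟨K, hK1, hK⟩ := exists_expCutoff_bound
  have hK0 : 0 ≤ K := by linarith
  refine ⟨K * (N + 3), by positivity, fun m x => ?_⟩
  set ρ := √(‖x‖ ^ 2 + (1 / ((m : ℝ) + 1)) ^ 2) with hρ
  obtain ⟨hg, hl⟩ := gradient_laplacian_hydrogenTrial i m x hρ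
  obtain ⟨b0, b1, b2⟩ := hK m ρ
  have hρ0 : 0 < ρ := by positivity
  have hle : ‖x‖ ≤ ρ := Real.le_sqrt_of_sq_le (by
    have := sq_nonneg (1 / ((m : ℝ) + 1))
    linarith)
  have hexp : Real.exp (-ρ) ≤ Real.exp (-‖x‖) := Real.exp_le_exp.2 (by linarith)
  have hq : ‖x‖ / ρ ≤ 1 := (div_le_one hρ0).2 hle
  have hq0 : 0 ≤ ‖x‖ / ρ := by positivity
  have hxi : |x i| ≤ ‖x‖ := PiLp.norm_apply_le x i
  have hE := Real.exp_pos (-‖x‖)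
  have c0 : |expCutoff m ρ| ≤ K * Real.exp (-‖x‖) :=
    b0.trans (hexp.trans (le_mul_of_one_le_left hE.le hK1))
  have c1 : |expCutoffDeriv m ρ| ≤ K * Real.exp (-‖x‖) :=
    b1.trans (mul_le_mul_of_nonneg_left hexp hK0)
  have c2 : |expCutoffDeriv₂ m ρ| ≤ K * Real.exp (-‖x‖) :=
    b2.trans (mul_le_mul_of_nonneg_left hexp hK0)
  set Q := K * Real.exp (-‖x‖) with hQ
  have hQ0 : 0 ≤ Q := by positivity
  have hN0 : 0 ≤ (N : ℝ) := Nat.cast_nonneg N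
  have d1 : |x i| * (|expCutoffDeriv m ρ| / ρ) ≤ Q := by
    calc |x i| * (|expCutoffDeriv m ρ| / ρ) ≤ ‖x‖ * (Q / ρ) := by gcongr
      _ = Q * (‖x‖ / ρ) := by ring
      _ ≤ Q * 1 := by gcongr
      _ = Q := mul_one Q
  have hx2 : (‖x‖ / ρ) ^ 2 ≤ 1 := pow_le_one₀ hq0 hq
  constructor
  · rw [hg]
    calc _ ≤ |expCutoff m ρ| + |x i| * (|expCutoffDeriv m ρ| / ρ) * ‖x‖ := by
          refine (norm_add_le _ _).trans ?_
          simp [norm_smul, abs_of_pos hρ0]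
      _ ≤ Q + Q * ‖x‖ := by gcongr
      _ = 1 * (Q * (1 + ‖x‖)) := by ring
      _ ≤ (N + 3) * (Q * (1 + ‖x‖)) := by gcongr; linarith
      _ = _ := by rw [hQ]; ring
  · rw [hl]
    have e : x i * ((N + 2) * (expCutoffDeriv m ρ / ρ) +
        ‖x‖ ^ 2 * (expCutoffDeriv₂ m ρ / ρ ^ 2 - expCutoffDeriv m ρ / ρ ^ 3)) =
        (N + 2) * (x i * (expCutoffDeriv m ρ / ρ)) + (‖x‖ / ρ) ^ 2 * (x i * expCutoffDeriv₂ m ρ)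
          - (‖x‖ / ρ) ^ 2 * (x i * (expCutoffDeriv m ρ / ρ)) := by
      field_simp
      ring
    rw [e]
    have d1' : |x i * (expCutoffDeriv m ρ / ρ)| ≤ Q := by
      rw [abs_mul, abs_div, abs_of_pos hρ0]; exact d1
    have d2' : |x i * expCutoffDeriv₂ m ρ| ≤ ‖x‖ * Q := by
      rw [abs_mul]; gcongr
    calc _ ≤ (N + 2) * Q + 1 * (‖x‖ * Q) + 1 * Q := by
          refine (abs_sub _ _).trans (add_le_add ((abs_add_le _ _).trans (add_le_add ?_ ?_)) ?_)
          · rw [abs_mul, abs_of_nonneg (by positivity)]; gcongr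
          · rw [abs_mul, abs_of_nonneg (by positivity)]; gcongr
          · rw [abs_mul, abs_of_nonneg (by positivity)]; gcongr
      _ = Q * (N + 3 + ‖x‖) := by ring
      _ ≤ Q * ((N + 3) * (1 + ‖x‖)) := by
          gcongr
          nlinarith [norm_nonneg x]
      _ = _ := by rw [hQ]; ring

/-- The limits are the squared gradient and squared Laplacian of `x_i e^{-|x|}`. -/
lemma tendsto_hydrogenTrial (i : Fin N) {x : EuclideanSpace ℝ (Fin N)} (hx : x ≠ 0) :
    Tendsto (fun m => ‖gradient (hydrogenTrial i m) x‖ ^ 2) atTop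
      (𝓝 (Real.exp (-(2 * ‖x‖)) + x i ^ 2 * ((1 - 2 * ‖x‖⁻¹) * Real.exp (-(2 * ‖x‖))))) ∧
    Tendsto (fun m => Laplacian.laplacian (hydrogenTrial i m) x ^ 2) atTop
      (𝓝 (x i ^ 2 * ((1 - (N + 1) * ‖x‖⁻¹) ^ 2 * Real.exp (-(2 * ‖x‖))))) := by
  have hr : 0 < ‖x‖ := norm_pos_iff.2 hx
  set ρ : ℕ → ℝ := fun m => √(‖x‖ ^ 2 + (1 / ((m : ℝ) + 1)) ^ 2) with hρ
  have hρl : Tendsto ρ atTop (𝓝 ‖x‖) := by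
    have h1 : Tendsto (fun m : ℕ => ‖x‖ ^ 2 + (1 / ((m : ℝ) + 1)) ^ 2) atTop
        (𝓝 (‖x‖ ^ 2 + 0 ^ 2)) :=
      tendsto_const_nhds.add (tendsto_one_div_add_atTop_nhds_zero_nat.pow 2)
    have h2 := (Real.continuous_sqrt.tendsto _).comp h1
    have h3 : √(‖x‖ ^ 2 + 0 ^ 2) = ‖x‖ := by
      rw [zero_pow two_ne_zero, add_zero, Real.sqrt_sq hr.le]
    rwa [h3] at h2
  obtain ⟨t0, t1, t2⟩ := tendsto_expCutoff hρl
  have hexp : Real.exp (-(2 * ‖x‖)) = Real.exp (-‖x‖) ^ 2 := by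
    rw [← Real.exp_nat_mul]; congr 1; push_cast; ring
  set ε := Real.exp (-‖x‖) with hε
  have hdiv := t1.div hρl hr.ne'
  constructor
  · have h1 : Tendsto (fun m => gradient (hydrogenTrial i m) x) atTop
        (𝓝 (ε • EuclideanSpace.single i (1 : ℝ) + (x i * (-ε / ‖x‖)) • x)) := by
      have := (t0.smul_const (EuclideanSpace.single i (1 : ℝ))).add
        ((hdiv.const_mul (x i)).smul_const x)
      refine this.congr fun m => ?_
      rw [(gradient_laplacian_hydrogenTrial i m x (ρ := ρ m) rfl).1]
      rfl
    have h2 := (h1.norm).pow 2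
    convert h2 using 2
    have hn : ‖EuclideanSpace.single i (1 : ℝ)‖ = 1 := by simp
    rw [norm_add_sq_real, norm_smul, norm_smul, hn, real_inner_smul_left, real_inner_smul_right,
      EuclideanSpace.inner_single_left, hexp, mul_pow, mul_pow, Real.norm_eq_abs, Real.norm_eq_abs,
      sq_abs, sq_abs]
    simp only [map_one, one_mul]
    field_simp
    ring
  · have h1 : Tendsto (fun m => Laplacian.laplacian (hydrogenTrial i m) x) atTop
        (𝓝 (x i * ((N + 2) * (-ε / ‖x‖) + ‖x‖ ^ 2 * (ε / ‖x‖ ^ 2 - -ε / ‖x‖ ^ 3)))) := by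
      have := ((hdiv.const_mul ((N : ℝ) + 2)).add
        (((t2.div (hρl.pow 2) (by positivity)).sub
          (t1.div (hρl.pow 3) (by positivity))).const_mul (‖x‖ ^ 2))).const_mul (x i)
      refine this.congr fun m => ?_
      rw [(gradient_laplacian_hydrogenTrial i m x (ρ := ρ m) rfl).2]
      rfl
    convert h1.pow 2 using 2
    rw [hexp]
    field_simp
    ring

/-- The upper bound for the sharp constant obtained from `x_i e^{-|x|}`. -/
lemma le_of_mem_testConstants (hN : 2 ≤ N) {C : ℝ} (hC : C ∈ testConstants N) :
    C ≤ (N : ℝ) * ((N : ℝ) + 4) * ((N : ℝ) ^ 2 - 1) ^ 2 / (4 * ((N : ℝ) ^ 2 - N + 4) ^ 2) := by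
  have hN2 : (2 : ℝ) ≤ N := by exact_mod_cast hN
  set i : Fin N := ⟨0, by omega⟩
  have hnt : Nontrivial (EuclideanSpace ℝ (Fin N)) :=
    Module.nontrivial_of_finrank_pos (R := ℝ) (by simp; omega)
  have ae0 : ∀ᵐ x : EuclideanSpace ℝ (Fin N), x ≠ 0 := by simp [ae_iff]
  obtain ⟨K, hK0, hK⟩ := exists_hydrogenTrial_bound i
  -- With `μ = ∫ e^{-2|x|}` as unit, all three limiting integrals are rational functions of `N`, and
  -- `μ²` cancels at the end.
  set μ := sphereArea N * ((N - 1).factorial / 2 ^ N) with hμ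
  have hμ0 : 0 < μ := mul_pos (sphereArea_pos hN) (by positivity)
  have hexp : ∀ r : ℝ, Real.exp (-(2 * r)) = Real.exp (-r) ^ 2 := fun r => by
    rw [← Real.exp_nat_mul]; congr 1; push_cast; ring
  have hb1 : Integrable fun x : EuclideanSpace ℝ (Fin N) =>
      (K * ((1 + ‖x‖) * Real.exp (-‖x‖))) ^ 2 :=
    (integral_radial_quadratic_exp hN (K ^ 2) (2 * K ^ 2) (K ^ 2) 0
      (f := fun r => (K * ((1 + r) * Real.exp (-r))) ^ 2) fun r _ => by rw [hexp]; ring).1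
  have hb2 : Integrable fun x : EuclideanSpace ℝ (Fin N) =>
      (K * ((1 + ‖x‖) * Real.exp (-‖x‖))) ^ 2 / ‖x‖ :=
    (integral_radial_quadratic_exp hN 0 (K ^ 2) (2 * K ^ 2) (K ^ 2)
      (f := fun r => (K * ((1 + r) * Real.exp (-r))) ^ 2 / r) fun r hr => by
        rw [hexp]; field_simp; ring).1
  have hBlim : Tendsto (fun m => ∫ x, ‖gradient (hydrogenTrial i m) x‖ ^ 2) atTop
      (𝓝 (∫ x : EuclideanSpace ℝ (Fin N), (Real.exp (-(2 * ‖x‖)) +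
        x i ^ 2 * ((1 - 2 * ‖x‖⁻¹) * Real.exp (-(2 * ‖x‖)))))) := by
    refine tendsto_integral_of_dominated_convergence _ (fun m =>
      ((isTestFunction_hydrogenTrial i m).memLp_gradient.aestronglyMeasurable.norm.pow 2)) hb1
      (fun m => Eventually.of_forall fun x => ?_) ?_
    · rw [norm_pow, norm_norm]; gcongr; exact (hK m x).1
    · filter_upwards [ae0] with x hx using (tendsto_hydrogenTrial i hx).1
  have hAlim : Tendsto (fun m => ∫ x, Laplacian.laplacian (hydrogenTrial i m) x ^ 2) atTop
      (𝓝 (∫ x : EuclideanSpace ℝ (Fin N),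
        x i ^ 2 * ((1 - (N + 1) * ‖x‖⁻¹) ^ 2 * Real.exp (-(2 * ‖x‖))))) := by
    refine tendsto_integral_of_dominated_convergence _ (fun m =>
      ((isTestFunction_hydrogenTrial i m).memLp_laplacian.aestronglyMeasurable.pow 2)) hb1
      (fun m => Eventually.of_forall fun x => ?_) ?_
    · rw [norm_pow, Real.norm_eq_abs]; gcongr; exact (hK m x).2
    · filter_upwards [ae0] with x hx using (tendsto_hydrogenTrial i hx).2
  have hDlim : Tendsto (fun m => ∫ x, ‖gradient (hydrogenTrial i m) x‖ ^ 2 / ‖x‖) atTop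
      (𝓝 (∫ x : EuclideanSpace ℝ (Fin N), (Real.exp (-(2 * ‖x‖)) +
        x i ^ 2 * ((1 - 2 * ‖x‖⁻¹) * Real.exp (-(2 * ‖x‖)))) / ‖x‖)) := by
    refine tendsto_integral_of_dominated_convergence _ (fun m =>
      (hC _ (isTestFunction_hydrogenTrial i m)).1.aestronglyMeasurable) hb2
      (fun m => Eventually.of_forall fun x => ?_) ?_
    · rw [norm_div, norm_pow, norm_norm, norm_norm]; gcongr; exact (hK m x).1
    · filter_upwards [ae0] with x hx using (tendsto_hydrogenTrial i hx).1.div_const _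
  have hA : ∫ x : EuclideanSpace ℝ (Fin N),
      x i ^ 2 * ((1 - (N + 1) * ‖x‖⁻¹) ^ 2 * Real.exp (-(2 * ‖x‖))) =
      μ * ((N + 1) * (N + 4) / (4 * N)) := by
    rw [(integral_coord_sq_radial_quadratic_exp hN 1 (-(2 * (N + 1))) ((N + 1) ^ 2) 0
      (F := fun r => (1 - (N + 1) * r⁻¹) ^ 2 * Real.exp (-(2 * r))) (by fun_prop)
      (fun r hr => by field_simp; ring) i).2, ← hμ]
    field_simp
    ring
  have hB : ∫ x : EuclideanSpace ℝ (Fin N), (Real.exp (-(2 * ‖x‖)) +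
      x i ^ 2 * ((1 - 2 * ‖x‖⁻¹) * Real.exp (-(2 * ‖x‖)))) = μ * ((N + 1) / 4) := by
    obtain ⟨p1, q1⟩ := integral_radial_quadratic_exp hN 0 0 1 0
      (f := fun r => Real.exp (-(2 * r))) (fun r hr => by ring)
    obtain ⟨p2, q2⟩ := integral_coord_sq_radial_quadratic_exp hN 1 (-2) 0 0
      (F := fun r => (1 - 2 * r⁻¹) * Real.exp (-(2 * r))) (by fun_prop)
      (fun r hr => by field_simp; ring) i
    rw [integral_add p1 p2, q1, q2, ← hμ]
    field_simp
    ring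
  have hD : ∫ x : EuclideanSpace ℝ (Fin N), (Real.exp (-(2 * ‖x‖)) +
      x i ^ 2 * ((1 - 2 * ‖x‖⁻¹) * Real.exp (-(2 * ‖x‖)))) / ‖x‖ =
      μ * ((N ^ 2 - N + 4) / (2 * N * (N - 1))) := by
    obtain ⟨p1, q1⟩ := integral_radial_quadratic_exp hN 0 0 0 1
      (f := fun r => Real.exp (-(2 * r)) * r⁻¹) (fun r hr => by ring)
    obtain ⟨p2, q2⟩ := integral_coord_sq_radial_quadratic_exp hN 0 1 (-2) 0
      (F := fun r => (1 - 2 * r⁻¹) * Real.exp (-(2 * r)) * r⁻¹) (by fun_prop)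
      (fun r hr => by field_simp; ring) i
    simp only [div_eq_mul_inv, add_mul, mul_assoc] at p1 p2 q1 q2 ⊢
    rw [integral_add p1 p2, q1, q2]
    have : (N : ℝ) - 1 ≠ 0 := by linarith
    rw [hμ]
    field_simp
    ring
  rw [hA] at hAlim
  rw [hB] at hBlim
  rw [hD] at hDlim
  have hfin := le_of_tendsto_of_tendsto' ((hDlim.pow 2).const_mul C) (hAlim.mul hBlim)
    fun m => (hC _ (isTestFunction_hydrogenTrial i m)).2
  have hpos : 0 < (N : ℝ) ^ 2 - N + 4 := by nlinarith
  have h1 : 0 < (N : ℝ) - 1 := by linarith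
  rw [le_div_iff₀ (by positivity)]
  have e1 : C * (μ * (((N : ℝ) ^ 2 - N + 4) / (2 * N * (N - 1)))) ^ 2 =
      μ ^ 2 / (16 * N ^ 2 * (N - 1) ^ 2) * (C * (4 * ((N : ℝ) ^ 2 - N + 4) ^ 2)) := by
    field_simp; ring
  have e2 : μ * (((N : ℝ) + 1) * (N + 4) / (4 * N)) * (μ * ((N + 1) / 4)) =
      μ ^ 2 / (16 * N ^ 2 * (N - 1) ^ 2) * (N * (N + 4) * ((N : ℝ) ^ 2 - 1) ^ 2) := by
    field_simp; ring
  rw [e1, e2] at hfin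
  exact le_of_mul_le_mul_left hfin (by positivity)

end Trial

/-! ### The sharp constant and the radial constant -/

section Sharp

variable {N : ℕ}

/-- The refined inequality in `H²_{0,0}`: the tangential and the radial part of the gradient enter
with different constants. -/
lemma MemH2.refined_hydrogen (hN : 2 ≤ N) {u : EuclideanSpace ℝ (Fin N) → ℝ}
    {G : EuclideanSpace ℝ (Fin N) → EuclideanSpace ℝ (Fin N)}
    {g : EuclideanSpace ℝ (Fin N) → ℝ} (hu : MemH2 u G g) :
    Integrable (fun x => radialDensity ((N : ℝ) + 1 - 2 / (N - 1)) (2 / (N - 1)) x (G x)) ∧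
      (∫ x, radialDensity ((N : ℝ) + 1 - 2 / (N - 1)) (2 / (N - 1)) x (G x)) ^ 2 ≤
        4 * ((∫ x, g x ^ 2) * ∫ x, ‖G x‖ ^ 2) := by
  have hN2 : (2 : ℝ) ≤ N := by exact_mod_cast hN
  have h1 : 0 < (N : ℝ) - 1 := by linarith
  have hd : 2 ≤ Module.finrank ℝ (EuclideanSpace ℝ (Fin N)) := by simpa using hN
  have h2 : 2 / ((N : ℝ) - 1) ≤ 2 := by rw [div_le_iff₀ h1]; linarith
  refine hu.sq_integral_radialDensity_le (by linarith) (by positivity) (by norm_num) fun φ hφ => ?_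
  refine ⟨integrable_radialDensity hd _ _ (hφ.1.gradient_infty.of_le (by simp)) hφ.2.gradient', ?_⟩
  have := sq_integral_radialDensity_gradient_le hd (n := (N : ℝ) - 1) (by simp) hφ.1 hφ.2
  rw [show (N : ℝ) - 1 + 2 - 2 / (N - 1) = N + 1 - 2 / (N - 1) by ring] at this
  linarith

lemma IsTestFunction.integrable_weighted (hN : 2 ≤ N) {u : EuclideanSpace ℝ (Fin N) → ℝ}
    (hu : IsTestFunction u) : Integrable fun x => ‖gradient u x‖ ^ 2 / ‖x‖ := by
  have hd : 2 ≤ Module.finrank ℝ (EuclideanSpace ℝ (Fin N)) := by simpa using hN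
  have := integrable_radialDensity hd 1 0 (hu.1.gradient_infty.of_le (by simp)) hu.2.gradient'
  simpa only [radialDensity_one_zero] using this

/-- Positive constants for test functions are constants for `H²_{0,0}`. -/
lemma mem_sobolevConstants_of_pos {C : ℝ} (hC0 : 0 < C) (hC : C ∈ testConstants N) :
    C ∈ sobolevConstants N := by
  intro u G g hu
  -- Dividing by `C > 0` isolates the weighted integral, the form in which Fatou's lemma applies.
  have h := hu.sq_integral_radialDensity_le (a := 1) (c := 0) (K := C⁻¹) zero_le_one le_rfl
    (by positivity) fun φ hφ => by
      simp only [radialDensity_one_zero]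
      refine ⟨(hC φ hφ).1, ?_⟩
      rw [← div_eq_inv_mul, le_div_iff₀ hC0, mul_comm]
      exact (hC φ hφ).2
  simp only [radialDensity_one_zero] at h
  refine ⟨h.1, ?_⟩
  have := h.2
  rwa [← div_eq_inv_mul, le_div_iff₀ hC0, mul_comm] at this

lemma sobolevConstants_subset_testConstants : sobolevConstants N ⊆ testConstants N :=
  fun _ hC u hu => hC u _ _ hu.memH2

/-- Discard the nonnegative radial term from the refined inequality. -/
lemma lowerConstant_mem_testConstants (hN : 2 ≤ N) :
    (((N : ℝ) + 1 - 2 / (N - 1)) / 2) ^ 2 ∈ testConstants N := by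
  have hN2 : (2 : ℝ) ≤ N := by exact_mod_cast hN
  have h1 : 0 < (N : ℝ) - 1 := by linarith
  have h2 : 2 / ((N : ℝ) - 1) ≤ 2 := by rw [div_le_iff₀ h1]; linarith
  intro u hu
  have hi := hu.integrable_weighted hN
  refine ⟨hi, ?_⟩
  obtain ⟨hW, hle⟩ := hu.memH2.refined_hydrogen hN
  set a := (N : ℝ) + 1 - 2 / (N - 1) with ha
  have ha0 : 0 ≤ a := by linarith
  have hmono : a * ∫ x, ‖gradient u x‖ ^ 2 / ‖x‖ ≤
      ∫ x, radialDensity a (2 / (N - 1)) x (gradient u x) := by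
    rw [← integral_const_mul]
    refine integral_mono (hi.const_mul a) hW fun x => ?_
    simp only [radialDensity, div_eq_mul_inv, ← mul_assoc]
    gcongr
    have : 0 ≤ 2 * ((N : ℝ) - 1)⁻¹ * ⟪gradient u x, ‖x‖⁻¹ • x⟫ ^ 2 := by positivity
    linarith
  have h0 : 0 ≤ ∫ x, ‖gradient u x‖ ^ 2 / ‖x‖ := integral_nonneg fun x => by positivity
  have := (pow_le_pow_left₀ (mul_nonneg ha0 h0) hmono 2).trans hle
  rw [mul_pow] at this
  rw [div_pow]
  linarith

/-- The set of constants for test functions has a greatest element. -/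
lemma exists_isGreatest_testConstants (hN : 2 ≤ N) : ∃ C, IsGreatest (testConstants N) C := by
  have hne : (testConstants N).Nonempty := ⟨_, lowerConstant_mem_testConstants hN⟩
  have hbdd : BddAbove (testConstants N) := ⟨_, fun C hC => le_of_mem_testConstants hN hC⟩
  refine ⟨sSup (testConstants N), fun u hu => ⟨hu.integrable_weighted hN, ?_⟩,
    fun C hC => le_csSup hbdd hC⟩
  -- For each `u` the condition on `C` is vacuous or a closed upper bound, so it survives the
  -- supremum.
  rcases (sq_nonneg (∫ x, ‖gradient u x‖ ^ 2 / ‖x‖)).eq_or_lt with h | h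
  · rw [← h, mul_zero]
    exact mul_nonneg (integral_nonneg fun x => sq_nonneg _) (integral_nonneg fun x => sq_nonneg _)
  · rw [← le_div_iff₀ h]
    exact csSup_le hne fun C hC => (le_div_iff₀ h).2 (hC u hu).2

lemma weighted_integral_pos (hN : 2 ≤ N)
    {G : EuclideanSpace ℝ (Fin N) → EuclideanSpace ℝ (Fin N)}
    (hi : Integrable fun x => ‖G x‖ ^ 2 / ‖x‖) (hG : ¬ G =ᵐ[volume] 0) :
    0 < ∫ x, ‖G x‖ ^ 2 / ‖x‖ := by
  have hnt : Nontrivial (EuclideanSpace ℝ (Fin N)) :=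
    Module.nontrivial_of_finrank_pos (R := ℝ) (by simp; omega)
  have h0 : 0 ≤ ∫ x, ‖G x‖ ^ 2 / ‖x‖ := integral_nonneg fun x => by positivity
  refine h0.lt_of_ne fun h => hG ?_
  have := (integral_eq_zero_iff_of_nonneg (fun x => by positivity) hi).1 h.symm
  filter_upwards [this, show ∀ᵐ x : EuclideanSpace ℝ (Fin N), x ≠ 0 by simp [ae_iff]] with x h1 hx
  simpa [hx] using h1

/-- Radial functions satisfy the inequality with the constant `(N + 1)² / 4`. -/
lemma MemH2.radial_hydrogen (hN : 2 ≤ N) {u : EuclideanSpace ℝ (Fin N) → ℝ}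
    {G : EuclideanSpace ℝ (Fin N) → EuclideanSpace ℝ (Fin N)}
    {g : EuclideanSpace ℝ (Fin N) → ℝ} (hu : MemH2 u G g) (hr : IsRadialAE u) :
    ((N : ℝ) + 1) ^ 2 / 4 * (∫ x, ‖G x‖ ^ 2 / ‖x‖) ^ 2 ≤
      (∫ x, g x ^ 2) * ∫ x, ‖G x‖ ^ 2 := by
  have hnt : Nontrivial (EuclideanSpace ℝ (Fin N)) :=
    Module.nontrivial_of_finrank_pos (R := ℝ) (by simp; omega)
  have h := (hu.refined_hydrogen hN).2
  -- For a gradient parallel to `x` the two weights add and `2/(N - 1)` cancels.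
  have e : ∫ x, radialDensity ((N : ℝ) + 1 - 2 / (N - 1)) (2 / (N - 1)) x (G x) =
      ∫ x, ((N : ℝ) + 1) * (‖G x‖ ^ 2 / ‖x‖) := by
    refine integral_congr_ae ?_
    filter_upwards [hu.inner_sq_eq_of_isRadialAE hr,
      show ∀ᵐ x : EuclideanSpace ℝ (Fin N), x ≠ 0 by simp [ae_iff]] with x h1 hx
    have hx' : ‖x‖ ≠ 0 := norm_ne_zero_iff.2 hx
    have h2 : ⟪G x, ‖x‖⁻¹ • x⟫ ^ 2 = ‖G x‖ ^ 2 := by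
      rw [real_inner_smul_right, mul_pow, h1]; field_simp
    rw [radialDensity, h2]
    ring
  rw [e, integral_const_mul, mul_pow] at h
  linarith

end Sharp

theorem theorem1p1 (N : ℕ) (hN : N = 2 ∨ N = 3) :
    ∃ C : ℝ, IsGreatest (testConstants N) C ∧ IsGreatest (sobolevConstants N) C ∧
      ((N : ℝ) - 1) ^ 4 * ((N : ℝ) + 3) ^ 2 / (4 * ((N : ℝ) ^ 2 - 2 * N + 5) ^ 2) ≤ C ∧
      C ≤ (N : ℝ) * ((N : ℝ) + 4) * ((N : ℝ) ^ 2 - 1) ^ 2 / (4 * ((N : ℝ) ^ 2 - N + 4) ^ 2) ∧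
      (N : ℝ) * ((N : ℝ) + 4) * ((N : ℝ) ^ 2 - 1) ^ 2 / (4 * ((N : ℝ) ^ 2 - N + 4) ^ 2)
        < ((N : ℝ) + 1) ^ 2 / 4 ∧
      ∀ (u : EuclideanSpace ℝ (Fin N) → ℝ)
        (G : EuclideanSpace ℝ (Fin N) → EuclideanSpace ℝ (Fin N))
        (g : EuclideanSpace ℝ (Fin N) → ℝ), IsExtremal C u G g → ¬ IsRadialAE u := by
  have hN' : 2 ≤ N := by omega
  obtain ⟨C, hC⟩ := exists_isGreatest_testConstants hN'
  have hlow : ((N : ℝ) - 1) ^ 4 * ((N : ℝ) + 3) ^ 2 / (4 * ((N : ℝ) ^ 2 - 2 * N + 5) ^ 2) ≤ C := by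
    refine le_trans (le_of_eq ?_) (hC.2 (lowerConstant_mem_testConstants hN'))
    -- The proved constant is `(N² - 3)²/(4(N - 1)²)`; among `N ≥ 2` it equals the stated bound only
    -- for `N = 2, 3`.
    rcases hN with rfl | rfl <;> norm_num
  have hup := le_of_mem_testConstants hN' hC.1
  have hlt : (N : ℝ) * ((N : ℝ) + 4) * ((N : ℝ) ^ 2 - 1) ^ 2 / (4 * ((N : ℝ) ^ 2 - N + 4) ^ 2)
      < ((N : ℝ) + 1) ^ 2 / 4 := by
    rcases hN with rfl | rfl <;> norm_num
  have hC0 : 0 < C := by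
    refine lt_of_lt_of_le ?_ hlow
    rcases hN with rfl | rfl <;> norm_num
  have hCs : C ∈ sobolevConstants N := mem_sobolevConstants_of_pos hC0 hC.1
  refine ⟨C, hC, ⟨hCs, fun C' h => hC.2 (sobolevConstants_subset_testConstants h)⟩, hlow, hup, hlt,
    fun u G g hext hr => ?_⟩
  obtain ⟨hu, hG, heq⟩ := hext
  -- Cancelling the positive weighted integral would give `(N + 1)²/4 ≤ C`, contradicting `hup` and
  -- `hlt`.
  have hpos := weighted_integral_pos hN' (hCs u G g hu).1 hG
  have hrad := hu.radial_hydrogen hN' hr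
  rw [heq] at hrad
  have := le_of_mul_le_mul_right hrad (by positivity)
  linarith
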